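/- Let $d\in\mathbb{N}$ and let $a_1,a_2:\mathbb{R}^d\to\mathbb{R}^{d\times d}$ be measurable functions whose values are symmetric matrices, and suppose that there is a constant $\nu>0$ such that, for $i=1,2$ and almost every $x\in\mathbb{R}^d$, $$\nu|\xi|^2\le a_i(x)\,\xi\cdot\xi\le \nu^{-1}|\xi|^2\qquad\text{for all }\xi\in\mathbb{R}^d .$$ For $i=1,2$ let $T_i$ be the operator in the complex Hilbert space $L^2(\mathbb{R}^d)$ associated with the densely defined form $$\int_{\mathbb{R}^d} a_i\nabla u\cdot\overline{\nabla v},\qquad u,v\in W^{1,2}(\mathbb{R}^d),$$ that is, $u\in\operatorname{dom}(T_i)$ and $T_iu=f$ if and only if $u\in W^{1,2}(\mathbb{R}^d)$, $f\in L^2(\mathbb{R}^d)$ and $\int_{\mathbb{R}^d} a_i\nabla u\cdot\overline{\nabla v}=\int_{\mathbb{R}^d} f\,\overline{v}$ for all $v\in W^{1,2}(\mathbb{R}^d)$. Assume that $a_1$ and $a_2$ differ only on a bounded set, i.e. there is $R$ such that $a_1(x)=a_2(x)$ for almost every $x$ with $|x|\ge R$. Then $T_1$ and $T_2$ are self-adjoint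 and non-negative, and $$\sigma_{\mathrm{ess}}(T_1)=\sigma_{\mathrm{ess}}(T_2).$$ Here $\sigma_{\mathrm{ess}}(T)=\sigma(T)\setminus\sigma_d(T)$, where $\sigma(T)$ is the spectrum of $T$ and $\sigma_d(T)$, the discrete spectrum, is the set of eigenvalues of $T$ of finite multiplicity that are isolated points of $\sigma(T)$. -/

import Mathlib

open MeasureTheory
open scoped ContDiff ComplexConjugate Matrix

noncomputable section

namespace DivForm

/-- The Hilbert space `L²(ℝ^d)` of complex-valued square integrable functions. -/
abbrev L2 (d : ℕ) : Type :=
  Lp ℂ 2 (volume : Measure (EuclideanSpace ℝ (Fin d)))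

/-- The Hilbert space of square integrable fields `ℝ^d → ℂ^d`. -/
abbrev L2Field (d : ℕ) : Type :=
  Lp (EuclideanSpace ℂ (Fin d)) 2 (volume : Measure (EuclideanSpace ℝ (Fin d)))

/-- The `i`-th partial derivative of a real function on `ℝ^d`. -/
def partialDeriv {d : ℕ} (i : Fin d) (φ : EuclideanSpace ℝ (Fin d) → ℝ)
    (x : EuclideanSpace ℝ (Fin d)) : ℝ :=
  fderiv ℝ φ x (EuclideanSpace.single i 1)

/-- `g` is the weak gradient of `u`: `∫ (∂ᵢφ) u = - ∫ φ gᵢ` for all test functions `φ ∈ C_c^∞`. -/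
def HasWeakGradient {d : ℕ} (u : L2 d) (g : L2Field d) : Prop :=
  ∀ φ : EuclideanSpace ℝ (Fin d) → ℝ, ContDiff ℝ ∞ φ → HasCompactSupport φ →
    ∀ i : Fin d, ∫ x, partialDeriv i φ x • u x = - ∫ x, φ x • g x i

lemma memLp_testFunction {d : ℕ} {φ : EuclideanSpace ℝ (Fin d) → ℝ} (hφ : Continuous φ)
    (hs : HasCompactSupport φ) : MemLp φ 2 := hφ.memLp_of_hasCompactSupport hs

lemma continuous_partialDeriv {d : ℕ} {φ : EuclideanSpace ℝ (Fin d) → ℝ} (hφ : ContDiff ℝ ∞ φ)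
    (i : Fin d) : Continuous (partialDeriv i φ) :=
  (hφ.continuous_fderiv (by simp)).clm_apply continuous_const

lemma hasCompactSupport_partialDeriv {d : ℕ} {φ : EuclideanSpace ℝ (Fin d) → ℝ}
    (hs : HasCompactSupport φ) (i : Fin d) : HasCompactSupport (partialDeriv i φ) :=
  hs.fderiv_apply (𝕜 := ℝ) _

lemma memLp_coord {d : ℕ} (g : L2Field d) (i : Fin d) : MemLp (fun x ↦ g x i) 2 :=
  (EuclideanSpace.proj i : EuclideanSpace ℂ (Fin d) →L[ℂ] ℂ).comp_memLp' (Lp.memLp g)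

lemma integrable_smul {d : ℕ} {φ : EuclideanSpace ℝ (Fin d) → ℝ}
    {f : EuclideanSpace ℝ (Fin d) → ℂ} (hφ : MemLp φ 2) (hf : MemLp f 2) :
    Integrable (fun x ↦ φ x • f x) :=
  memLp_one_iff_integrable.1 (hf.smul hφ)

lemma HasWeakGradient.zero {d : ℕ} : HasWeakGradient (0 : L2 d) 0 := by
  intro φ _ _ i
  have h1 : ∫ x, partialDeriv i φ x • (0 : L2 d) x = ∫ _ : EuclideanSpace ℝ (Fin d), (0 : ℂ) := by
    refine integral_congr_ae ?_
    filter_upwards [Lp.coeFn_zero ℂ 2 (volume : Measure (EuclideanSpace ℝ (Fin d)))] with x hx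
    rw [hx]
    simp
  have h2 : ∫ x, φ x • (0 : L2Field d) x i = ∫ _ : EuclideanSpace ℝ (Fin d), (0 : ℂ) := by
    refine integral_congr_ae ?_
    filter_upwards [Lp.coeFn_zero (EuclideanSpace ℂ (Fin d)) 2
      (volume : Measure (EuclideanSpace ℝ (Fin d)))] with x hx
    rw [hx]
    simp
  rw [h1, h2]
  simp

lemma HasWeakGradient.add {d : ℕ} {u v : L2 d} {g h : L2Field d} (hu : HasWeakGradient u g)
    (hv : HasWeakGradient v h) : HasWeakGradient (u + v) (g + h) := by
  intro φ hφ hs i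
  have mφ := memLp_testFunction hφ.continuous hs
  have mφ' := memLp_testFunction (continuous_partialDeriv hφ i)
    (hasCompactSupport_partialDeriv hs i)
  have h1 : ∫ x, partialDeriv i φ x • (u + v) x
      = ∫ x, (partialDeriv i φ x • u x + partialDeriv i φ x • v x) := by
    refine integral_congr_ae ?_
    filter_upwards [Lp.coeFn_add u v] with x hx
    rw [hx]
    simp
  have h2 : ∫ x, φ x • (g + h) x i = ∫ x, (φ x • g x i + φ x • h x i) := by
    refine integral_congr_ae ?_
    filter_upwards [Lp.coeFn_add g h] with x hx
    rw [hx]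
    simp
  rw [h1, h2, integral_add (integrable_smul mφ' (Lp.memLp u)) (integrable_smul mφ' (Lp.memLp v)),
    integral_add (integrable_smul mφ (memLp_coord g i)) (integrable_smul mφ (memLp_coord h i)),
    hu φ hφ hs i, hv φ hφ hs i]
  ring

lemma HasWeakGradient.smul {d : ℕ} {u : L2 d} {g : L2Field d} (c : ℂ)
    (hu : HasWeakGradient u g) : HasWeakGradient (c • u) (c • g) := by
  intro φ hφ hs i
  have h1 : ∫ x, partialDeriv i φ x • (c • u) x = ∫ x, c * (partialDeriv i φ x • u x) := by
    refine integral_congr_ae ?_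
    filter_upwards [Lp.coeFn_smul c u] with x hx
    simp only [hx, Pi.smul_apply, Complex.real_smul, smul_eq_mul]
    ring
  have h2 : ∫ x, φ x • (c • g) x i = ∫ x, c * (φ x • g x i) := by
    refine integral_congr_ae ?_
    filter_upwards [Lp.coeFn_smul c g] with x hx
    simp only [hx, Pi.smul_apply, PiLp.smul_apply, Complex.real_smul, smul_eq_mul]
    ring
  rw [h1, h2, integral_const_mul, integral_const_mul, hu φ hφ hs i]
  ring

/-- The graph of the weak gradient, a subspace of `L²(ℝ^d) × L²(ℝ^d; ℂ^d)`. -/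
def weakGradientGraph (d : ℕ) : Submodule ℂ (L2 d × L2Field d) where
  carrier := {p | HasWeakGradient p.1 p.2}
  zero_mem' := HasWeakGradient.zero
  add_mem' hp hq := HasWeakGradient.add hp hq
  smul_mem' c _ hp := HasWeakGradient.smul c hp

/-- The weak gradient as an unbounded operator; its domain is the Sobolev space `W^{1,2}(ℝ^d)`. -/
def weakGradient (d : ℕ) : L2 d →ₗ.[ℂ] L2Field d :=
  (weakGradientGraph d).toLinearPMap

/-- The Sobolev space `W^{1,2}(ℝ^d)`. -/
abbrev W12 (d : ℕ) : Submodule ℂ (L2 d) := (weakGradient d).domain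

/-- The weak gradient is unique. -/
lemma weakGradientGraph_functional (d : ℕ) :
    ∀ p : L2 d × L2Field d, p ∈ weakGradientGraph d → p.1 = 0 → p.2 = 0 := by
  rintro ⟨u, g⟩ hp (rfl : u = 0)
  have key : ∀ i : Fin d, ∀ᵐ x, g x i = 0 := by
    intro i
    refine ae_eq_zero_of_integral_contDiff_smul_eq_zero
      ((memLp_coord g i).locallyIntegrable (by norm_num)) fun φ hφ hs ↦ ?_
    have h1 := hp φ hφ hs i
    have h2 := HasWeakGradient.zero (d := d) φ hφ hs i
    have h3 : ∫ x, φ x • (0 : L2Field d) x i = ∫ _ : EuclideanSpace ℝ (Fin d), (0 : ℂ) := by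
      refine integral_congr_ae ?_
      filter_upwards [Lp.coeFn_zero (EuclideanSpace ℂ (Fin d)) 2
        (volume : Measure (EuclideanSpace ℝ (Fin d)))] with x hx
      rw [hx]
      simp
    have h4 := h1.symm.trans h2
    rw [h3] at h4
    simpa using h4
  change g = 0
  refine (Lp.eq_zero_iff_ae_eq_zero).2 ?_
  filter_upwards [ae_all_iff.2 key] with x hx
  ext i
  simpa using hx i

lemma mem_graph_weakGradient {d : ℕ} (u : L2 d) (g : L2Field d) :
    (u, g) ∈ (weakGradient d).graph ↔ HasWeakGradient u g := by
  rw [weakGradient, Submodule.toLinearPMap_graph_eq _ (weakGradientGraph_functional d)]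
  rfl

/-- Admissible coefficients: measurable, real symmetric, with
`ν |ξ|² ≤ a(x) ξ · ξ ≤ ν⁻¹ |ξ|²` for almost every `x` and all `ξ ∈ ℝ^d`. -/
structure IsUniformlyElliptic {d : ℕ} (ν : ℝ)
    (a : EuclideanSpace ℝ (Fin d) → Matrix (Fin d) (Fin d) ℝ) : Prop where
  pos : 0 < ν
  measurable : ∀ i j, Measurable fun x ↦ a x i j
  symm : ∀ᵐ x, (a x).IsSymm
  lower : ∀ᵐ x, ∀ ξ : Fin d → ℝ, ν * (ξ ⬝ᵥ ξ) ≤ (a x *ᵥ ξ) ⬝ᵥ ξ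
  upper : ∀ᵐ x, ∀ ξ : Fin d → ℝ, (a x *ᵥ ξ) ⬝ᵥ ξ ≤ ν⁻¹ * (ξ ⬝ᵥ ξ)

/-- The form `∫ a ∇u · conj ∇v`, written through the gradients `g = ∇u` and `h = ∇v`. -/
def fieldForm {d : ℕ} (a : EuclideanSpace ℝ (Fin d) → Matrix (Fin d) (Fin d) ℝ)
    (g h : L2Field d) : ℂ :=
  ∫ x, ∑ i, (∑ j, (a x i j : ℂ) * g x j) * conj (h x i)

/-- The form `∫ a ∇u · conj ∇v` on `W^{1,2}(ℝ^d)`. -/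
def form {d : ℕ} (a : EuclideanSpace ℝ (Fin d) → Matrix (Fin d) (Fin d) ℝ)
    (u v : W12 d) : ℂ :=
  fieldForm a (weakGradient d u) (weakGradient d v)

lemma IsUniformlyElliptic.abs_entry_le {d : ℕ} {ν : ℝ}
    {a : EuclideanSpace ℝ (Fin d) → Matrix (Fin d) (Fin d) ℝ} (ha : IsUniformlyElliptic ν a) :
    ∀ᵐ x, ∀ i j, |a x i j| ≤ ν⁻¹ := by
  filter_upwards [ha.symm, ha.lower, ha.upper] with x hs hl hu i j
  have hij := hs.apply i j
  have e : ∀ s t : ℝ, (a x *ᵥ (Pi.single i s + Pi.single j t)) ⬝ᵥ (Pi.single i s + Pi.single j t)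
      = s * s * a x i i + 2 * s * t * a x i j + t * t * a x j j := by
    intro s t
    simp [Matrix.mulVec_add, Matrix.mulVec_single, hij]
    ring
  have n : ∀ s t : ℝ, (Pi.single i s + Pi.single j t : Fin d → ℝ) ⬝ᵥ
      (Pi.single i s + Pi.single j t) ≤ 2 * (s * s + t * t) := by
    intro s t
    by_cases h : i = j
    · subst h
      simp
      nlinarith [sq_nonneg (s - t)]
    · simp [h, Ne.symm h]
      nlinarith [sq_nonneg s, sq_nonneg t]
  have nn : ∀ ξ : Fin d → ℝ, 0 ≤ (a x *ᵥ ξ) ⬝ᵥ ξ := fun ξ ↦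
    (mul_nonneg ha.pos.le (Finset.sum_nonneg fun k _ ↦ mul_self_nonneg (ξ k))).trans (hl ξ)
  have hν : 0 ≤ ν⁻¹ := inv_nonneg.2 ha.pos.le
  have p1 := nn (Pi.single i 1 + Pi.single j 1)
  have p2 := nn (Pi.single i 1 + Pi.single j (-1))
  have q1 := (hu (Pi.single i 1 + Pi.single j 1)).trans
    (mul_le_mul_of_nonneg_left (n 1 1) hν)
  have q2 := (hu (Pi.single i 1 + Pi.single j (-1))).trans
    (mul_le_mul_of_nonneg_left (n 1 (-1)) hν)
  rw [e] at p1 p2 q1 q2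
  rw [abs_le]
  constructor <;> linarith

lemma IsUniformlyElliptic.integrable_fieldForm {d : ℕ} {ν : ℝ}
    {a : EuclideanSpace ℝ (Fin d) → Matrix (Fin d) (Fin d) ℝ} (ha : IsUniformlyElliptic ν a)
    (g h : L2Field d) :
    Integrable fun x ↦ ∑ i, (∑ j, (a x i j : ℂ) * g x j) * conj (h x i) := by
  simp only [Finset.sum_mul]
  refine integrable_finsetSum _ fun i _ ↦ integrable_finsetSum _ fun j _ ↦ ?_
  have h1 : Integrable fun x ↦ g x j * conj (h x i) :=
    memLp_one_iff_integrable.1 ((memLp_coord h i).star.mul (memLp_coord g j))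
  simp only [mul_assoc]
  refine h1.bdd_mul (c := ν⁻¹)
    (Complex.measurable_ofReal.comp (ha.measurable i j)).aestronglyMeasurable ?_
  filter_upwards [ha.abs_entry_le] with x hx
  simpa using hx i j

lemma IsUniformlyElliptic.fieldForm_add {d : ℕ} {ν : ℝ}
    {a : EuclideanSpace ℝ (Fin d) → Matrix (Fin d) (Fin d) ℝ} (ha : IsUniformlyElliptic ν a)
    (g g' h : L2Field d) : fieldForm a (g + g') h = fieldForm a g h + fieldForm a g' h := by
  rw [fieldForm, fieldForm, fieldForm, ← integral_add (ha.integrable_fieldForm g h)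
    (ha.integrable_fieldForm g' h)]
  refine integral_congr_ae ?_
  filter_upwards [Lp.coeFn_add g g'] with x hx
  rw [hx]
  simp [mul_add, add_mul, Finset.sum_add_distrib]

lemma fieldForm_smul {d : ℕ} (a : EuclideanSpace ℝ (Fin d) → Matrix (Fin d) (Fin d) ℝ) (c : ℂ)
    (g h : L2Field d) : fieldForm a (c • g) h = c * fieldForm a g h := by
  rw [fieldForm, fieldForm, ← integral_const_mul]
  refine integral_congr_ae ?_
  filter_upwards [Lp.coeFn_smul c g] with x hx
  simp only [hx, Pi.smul_apply, PiLp.smul_apply, smul_eq_mul, Finset.mul_sum, Finset.sum_mul]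
  refine Finset.sum_congr rfl fun i _ ↦ Finset.sum_congr rfl fun j _ ↦ ?_
  ring

/-- The graph of the operator associated with the form: the pairs `(u, f)` with
`u ∈ W^{1,2}`, `f ∈ L²` and `∫ a ∇u · conj ∇v = ∫ f conj v` for all `v ∈ W^{1,2}`. -/
def operatorGraph {d : ℕ} {ν : ℝ} {a : EuclideanSpace ℝ (Fin d) → Matrix (Fin d) (Fin d) ℝ}
    (ha : IsUniformlyElliptic ν a) : Submodule ℂ (L2 d × L2 d) where
  carrier := {p | ∃ u : W12 d, (u : L2 d) = p.1 ∧ ∀ v : W12 d, form a u v = inner ℂ (v : L2 d) p.2}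
  zero_mem' := by
    refine ⟨0, rfl, fun v ↦ ?_⟩
    have := fieldForm_smul a 0 0 (weakGradient d v)
    simp only [zero_smul, zero_mul] at this
    simp [form, LinearPMap.map_zero, this]
  add_mem' := by
    rintro ⟨_, f⟩ ⟨_, f'⟩ ⟨u, rfl, hu⟩ ⟨u', rfl, hu'⟩
    refine ⟨u + u', rfl, fun v ↦ ?_⟩
    have h1 := hu v
    have h2 := hu' v
    simp only [form] at h1 h2
    simp only [form, LinearPMap.map_add, ha.fieldForm_add, Prod.snd_add, inner_add_right, h1, h2]
  smul_mem' := by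
    rintro c ⟨_, f⟩ ⟨u, rfl, hu⟩
    refine ⟨c • u, rfl, fun v ↦ ?_⟩
    have h1 := hu v
    simp only [form] at h1
    simp only [form, LinearPMap.map_smul, fieldForm_smul, Prod.smul_snd, inner_smul_right, h1]

/-- The operator `T = - div (a ∇ ·)` in `L²(ℝ^d)` associated with the form
`∫ a ∇u · conj ∇v` on `W^{1,2}(ℝ^d)`. -/
def operator {d : ℕ} {ν : ℝ} {a : EuclideanSpace ℝ (Fin d) → Matrix (Fin d) (Fin d) ℝ}
    (ha : IsUniformlyElliptic ν a) : L2 d →ₗ.[ℂ] L2 d :=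
  (operatorGraph ha).toLinearPMap

/-- The complex-valued class of a real test function. -/
def testL2 {d : ℕ} {φ : EuclideanSpace ℝ (Fin d) → ℝ} (hφ : ContDiff ℝ ∞ φ)
    (hs : HasCompactSupport φ) : L2 d :=
  (memLp_testFunction hφ.continuous hs).ofReal.toLp _

/-- Test functions belong to `W^{1,2}(ℝ^d)`. -/
lemma testL2_mem_W12 {d : ℕ} {φ : EuclideanSpace ℝ (Fin d) → ℝ} (hφ : ContDiff ℝ ∞ φ)
    (hs : HasCompactSupport φ) : testL2 hφ hs ∈ W12 d := by
  have hG : MemLp (fun x ↦ (WithLp.toLp 2 fun i ↦ (partialDeriv i φ x : ℂ) :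
      EuclideanSpace ℂ (Fin d))) 2 (volume : Measure (EuclideanSpace ℝ (Fin d))) := by
    refine Continuous.memLp_of_hasCompactSupport ?_ ?_
    · refine (PiLp.continuous_toLp 2 _).comp (continuous_pi fun i ↦ ?_)
      exact Complex.continuous_ofReal.comp (continuous_partialDeriv hφ i)
    · refine (hs.fderiv (𝕜 := ℝ)).mono fun x hx ↦ ?_
      contrapose! hx
      simp only [Function.mem_support, not_not] at hx ⊢
      ext i
      simp [partialDeriv, hx]
  have key : HasWeakGradient (testL2 hφ hs) (hG.toLp _) := by
    intro ψ hψ hsψ i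
    have h1 : ∫ x, partialDeriv i ψ x • testL2 hφ hs x
        = ∫ x, ((partialDeriv i ψ x * φ x : ℝ) : ℂ) := by
      refine integral_congr_ae ?_
      filter_upwards [(memLp_testFunction hφ.continuous hs).ofReal (K := ℂ).coeFn_toLp] with x hx
      rw [testL2, hx]
      simp
    have h2 : ∫ x, ψ x • (hG.toLp _) x i = ∫ x, ((ψ x * partialDeriv i φ x : ℝ) : ℂ) := by
      refine integral_congr_ae ?_
      filter_upwards [hG.coeFn_toLp] with x hx
      rw [hx]
      simp
    have mψ := memLp_testFunction hψ.continuous hsψ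
    have mφ := memLp_testFunction hφ.continuous hs
    have mψ' := memLp_testFunction (continuous_partialDeriv hψ i)
      (hasCompactSupport_partialDeriv hsψ i)
    have mφ' := memLp_testFunction (continuous_partialDeriv hφ i)
      (hasCompactSupport_partialDeriv hs i)
    have h3 : ∫ x, ψ x * partialDeriv i φ x = - ∫ x, partialDeriv i ψ x * φ x :=
      integral_mul_fderiv_eq_neg_fderiv_mul_of_integrable
        (memLp_one_iff_integrable.1 (mφ.mul mψ')) (memLp_one_iff_integrable.1 (mφ'.mul mψ))
        (memLp_one_iff_integrable.1 (mφ.mul mψ))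
        (fun x _ ↦ (hψ.differentiable (by simp)) x) (fun x _ ↦ (hφ.differentiable (by simp)) x)
    rw [h1, h2, integral_complex_ofReal, integral_complex_ofReal, h3]
    simp
  exact Submodule.mem_map.2 ⟨(testL2 hφ hs, hG.toLp _), key, rfl⟩

/-- The operator is well defined: its value is determined by its argument. -/
lemma operatorGraph_functional {d : ℕ} {ν : ℝ}
    {a : EuclideanSpace ℝ (Fin d) → Matrix (Fin d) (Fin d) ℝ} (ha : IsUniformlyElliptic ν a) :
    ∀ p : L2 d × L2 d, p ∈ operatorGraph ha → p.1 = 0 → p.2 = 0 := by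
  rintro ⟨w, f⟩ ⟨u, hu, huf⟩ (rfl : w = 0)
  obtain rfl : u = 0 := Subtype.ext hu
  refine (Lp.eq_zero_iff_ae_eq_zero).2 ?_
  refine ae_eq_zero_of_integral_contDiff_smul_eq_zero
    ((Lp.memLp f).locallyIntegrable (by norm_num)) fun φ hφ hs ↦ ?_
  have h1 := huf ⟨_, testL2_mem_W12 hφ hs⟩
  have h2 := fieldForm_smul a 0 0 (weakGradient d ⟨_, testL2_mem_W12 hφ hs⟩)
  simp only [zero_smul, zero_mul] at h2
  rw [form, LinearPMap.map_zero, h2, L2.inner_def] at h1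
  rw [h1]
  refine integral_congr_ae ?_
  filter_upwards [(memLp_testFunction hφ.continuous hs).ofReal (K := ℂ).coeFn_toLp] with x hx
  rw [testL2, hx]
  simp [mul_comm]

/-- `u` lies in the domain with `T u = f` iff `u ∈ W^{1,2}` and
`∫ a ∇u · conj ∇v = ∫ f conj v` for all `v ∈ W^{1,2}`. -/
lemma mem_graph_operator {d : ℕ} {ν : ℝ}
    {a : EuclideanSpace ℝ (Fin d) → Matrix (Fin d) (Fin d) ℝ} (ha : IsUniformlyElliptic ν a)
    (u f : L2 d) : (u, f) ∈ (operator ha).graph ↔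
      ∃ w : W12 d, (w : L2 d) = u ∧ ∀ v : W12 d, form a w v = inner ℂ (v : L2 d) f := by
  rw [operator, Submodule.toLinearPMap_graph_eq _ (operatorGraph_functional ha)]
  rfl

section Spectrum

variable {E : Type*} [NormedAddCommGroup E] [NormedSpace ℂ E]

/-- `z` is in the resolvent set of `T`: the map `T - z` from the domain of `T` to the whole space
has an everywhere defined bounded two-sided inverse. -/
def InResolventSet (T : E →ₗ.[ℂ] E) (z : ℂ) : Prop :=
  ∃ R : E →L[ℂ] E, (∀ u : T.domain, R (T u - z • (u : E)) = u) ∧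
    ∀ f : E, ∃ u : T.domain, (u : E) = R f ∧ T u - z • (u : E) = f

/-- The spectrum `σ(T)`. -/
def spec (T : E →ₗ.[ℂ] E) : Set ℂ := {z | ¬ InResolventSet T z}

/-- The eigenspace `ker (T - z)`. -/
def eigenspace (T : E →ₗ.[ℂ] E) (z : ℂ) : Submodule ℂ E where
  carrier := {u | (u, z • u) ∈ T.graph}
  zero_mem' := by
    change ((0 : E), z • (0 : E)) ∈ T.graph
    rw [smul_zero]
    exact T.graph.zero_mem
  add_mem' hu hv := by simpa [smul_add] using T.graph.add_mem hu hv
  smul_mem' c u hu := by simpa [smul_comm z c u] using T.graph.smul_mem c hu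

/-- The discrete spectrum `σ_d(T)`: the eigenvalues of finite multiplicity that are isolated
points of the spectrum. -/
def discreteSpec (T : E →ₗ.[ℂ] E) : Set ℂ :=
  {z | eigenspace T z ≠ ⊥ ∧ FiniteDimensional ℂ (eigenspace T z) ∧
    ∃ ε > 0, ∀ w ∈ spec T, w ≠ z → ε ≤ dist w z}

/-- The essential spectrum `σ_ess(T) = σ(T) \ σ_d(T)`. -/
def essSpec (T : E →ₗ.[ℂ] E) : Set ℂ := spec T \ discreteSpec T

end Spectrum

end DivForm

end

/-! Everything is read off the resolvents at -1. Give W^{1,2} its graph norm, with inclusion `J`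
into L² and gradient `G`, and let `M` be multiplication by the coefficients. The form plus the L²
inner product is represented by B = J* J + G* M G, which is coercive, so S = J B⁻¹ J* is a bounded
self-adjoint inverse of T + 1 (`isShiftedInverse_operator`). Self-adjointness of T follows
(`IsShiftedInverse.isSelfAdjoint`), and non-negativity is that of the form.

For the essential spectra it suffices that S₁ - S₂ is compact. With W = B₂⁻¹ J*, the second
resolvent identity gives S₁ - S₂ = J B₁⁻¹ G* (M₂ - M₁) G W, where M₂ - M₁ sees gradients only on a
bounded set. Rellich's theorem concerns functions, not gradients, so the equation must be used as
well, as in Caccioppoli's inequality. If m is multiplication by a cutoff η on W^{1,2}, then B₂ m -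
m* B₂ contains only terms with ∇η times the function itself, which Rellich makes compact. Hence B₂ m
W is compact, and so is m W as an operator into W^{1,2} (`isCompactOperator_resolventOp_sub`). No
regularity of the coefficients enters.

Rellich's theorem (`isCompactOperator_cutoffOp_inclOp`) holds because a cutoff is a norm limit, on
W^{1,2}, of averaging over small balls followed by the cutoff; these averages have square integrable
kernels.

Weyl's theorem rests on `IsShiftedInverse.notMem_essSpec_iff`: z avoids the essential spectrum
exactly when 1 - (z + 1) S becomes invertible after adding a compact operator. This condition
ignores compact changes of S. One direction is the Fredholm alternative, the other the continuous
functional calculus. -/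

noncomputable section

namespace DivForm

/-! ### Compact operators and the Fredholm alternative -/

section CompactOperators

variable {E F G : Type*} [NormedAddCommGroup E] [InnerProductSpace ℂ E]
  [NormedAddCommGroup F] [InnerProductSpace ℂ F] [NormedAddCommGroup G] [InnerProductSpace ℂ G]

/-- An operator `X` with `‖X f‖² ≤ ‖K f‖ ‖f‖` for a compact operator `K` is compact. -/
theorem isCompactOperator_of_norm_sq_le [CompleteSpace G] {K : E →L[ℂ] F}
    (hK : IsCompactOperator K) (X : E →L[ℂ] G) (h : ∀ f, ‖X f‖ ^ 2 ≤ ‖K f‖ * ‖f‖) :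
    IsCompactOperator X := by
  obtain ⟨C, hC, hCK⟩ :=
    hK.image_closedBall_subset_compact (𝕜₁ := ℂ) (f := (K : E →ₛₗ[RingHom.id ℂ] F)) 1
  have htb := hC.totallyBounded.subset hCK
  refine (isCompactOperator_iff_isCompact_closure_image_closedBall
    (X : E →ₛₗ[RingHom.id ℂ] G) one_pos).2 ?_
  refine isCompact_iff_totallyBounded_isComplete.2
    ⟨TotallyBounded.closure ?_, isClosed_closure.isComplete⟩
  refine Metric.totallyBounded_iff.2 fun ε hε ↦ ?_
  -- Differences of points of the unit ball have norm at most 2, so the net radius `ε ^ 2 / 2` gives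
  -- `‖X (f - p y)‖ ^ 2 < ε ^ 2`.
  obtain ⟨t, hts, htf, htc⟩ := Metric.finite_approx_of_totallyBounded htb (ε ^ 2 / 2) (by positivity)
  have hts' : ∀ y ∈ t, ∃ f, ‖f‖ ≤ 1 ∧ K f = y := fun y hy ↦ by
    obtain ⟨f, hf, hfy⟩ := hts hy
    exact ⟨f, by simpa using hf, hfy⟩
  choose! p hpb hpt using hts'
  refine ⟨(fun y ↦ X (p y)) '' t, htf.image _, ?_⟩
  rintro _ ⟨f, hf, rfl⟩
  obtain ⟨y, hy, hfy⟩ := Set.mem_iUnion₂.1 (htc ⟨f, hf, rfl⟩)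
  refine Set.mem_iUnion₂.2 ⟨X (p y), ⟨y, hy, rfl⟩, ?_⟩
  have hfb : ‖f‖ ≤ 1 := by simpa using hf
  have h1 : ‖K (f - p y)‖ < ε ^ 2 / 2 := by
    rw [map_sub, hpt y hy, ← dist_eq_norm]
    exact hfy
  have h2 : ‖f - p y‖ ≤ 2 := (norm_sub_le _ _).trans (by linarith [hpb y hy])
  have h3 := h (f - p y)
  have h4 : ‖X (f - p y)‖ ^ 2 < ε ^ 2 := by
    nlinarith [norm_nonneg (f - p y), norm_nonneg (K (f - p y))]
  have h5 : ‖X (f - p y)‖ < ε := lt_of_pow_lt_pow_left₀ 2 hε.le h4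
  change dist (X f) (X (p y)) < ε
  rwa [dist_eq_norm, ← map_sub]

/-- The adjoint of a compact operator between Hilbert spaces is compact. -/
theorem isCompactOperator_adjoint [CompleteSpace E] [CompleteSpace F] {K : E →L[ℂ] F}
    (hK : IsCompactOperator K) : IsCompactOperator (ContinuousLinearMap.adjoint K) := by
  have hc : IsCompactOperator (K ∘L ContinuousLinearMap.adjoint K) := hK.comp_clm _
  refine isCompactOperator_of_norm_sq_le hc _ fun f ↦ ?_
  rw [ContinuousLinearMap.apply_norm_sq_eq_inner_adjoint_left,
    ContinuousLinearMap.adjoint_adjoint]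
  exact (RCLike.re_le_norm _).trans (norm_inner_le_norm _ _)

theorem isCompactOperator_starProjection [CompleteSpace E] (N : Submodule ℂ E)
    [FiniteDimensional ℂ N] : IsCompactOperator N.starProjection :=
  (isCompactOperator_of_locallyCompactSpace_dom
    N.orthogonalProjectionOnto).clm_comp N.subtypeL

/-- A compact perturbation of an invertible operator is invertible as soon as it is injective. -/
theorem isUnit_add_of_isCompactOperator [CompleteSpace E] {A K : E →L[ℂ] E} (hA : IsUnit A)
    (hK : IsCompactOperator K) (hinj : ∀ x, (A + K) x = 0 → x = 0) : IsUnit (A + K) := by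
  obtain ⟨A, rfl⟩ := hA
  -- With A + K = A (1 - C), the Fredholm alternative for the compact `C` at 1 leaves only an
  -- eigenvector, which injectivity excludes.
  set C : E →L[ℂ] E := -(((A⁻¹ : (E →L[ℂ] E)ˣ) : E →L[ℂ] E) * K) with hCdef
  have hC : IsCompactOperator C := (hK.clm_comp ((A⁻¹ : (E →L[ℂ] E)ˣ) : E →L[ℂ] E)).neg
  have hfac : (A : E →L[ℂ] E) + K = A * (1 - C) := by
    rw [hCdef, sub_neg_eq_add, mul_add, mul_one, ← mul_assoc, Units.mul_inv, one_mul]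
  rcases hC.hasEigenvalue_or_mem_resolventSet one_ne_zero with h | h
  · obtain ⟨x, hx⟩ := h.exists_hasEigenvector
    refine absurd (hinj x ?_) hx.2
    have hCx : C x = x := by simpa using hx.apply_eq_smul
    rw [hfac, mul_apply_eq_comp]
    simp [hCx]
  · rw [hfac]
    refine A.isUnit.mul ?_
    simpa [spectrum.mem_resolventSet_iff] using h

/-- The kernel of a compact perturbation of an invertible operator has finite dimension. -/
theorem finiteDimensional_ker_add [CompleteSpace E] {A K : E →L[ℂ] E} (hA : IsUnit A)
    (hK : IsCompactOperator K) : FiniteDimensional ℂ (A + K).ker := by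
  obtain ⟨A, rfl⟩ := hA
  set C : E →L[ℂ] E := -(((A⁻¹ : (E →L[ℂ] E)ˣ) : E →L[ℂ] E) * K) with hCdef
  have hC : IsCompactOperator C := (hK.clm_comp ((A⁻¹ : (E →L[ℂ] E)ˣ) : E →L[ℂ] E)).neg
  have := ContinuousLinearMap.finite_dimensional_eigenspace hC 1 one_ne_zero
  refine Submodule.finiteDimensional_of_le
    (S₂ := Module.End.eigenspace C.toLinearMap 1) fun x hx ↦ ?_
  have hx' : (A : E →L[ℂ] E) x + K x = 0 := hx
  rw [Module.End.mem_eigenspace_iff, one_smul]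
  have h1 := congrArg ((A⁻¹ : (E →L[ℂ] E)ˣ) : E →L[ℂ] E) hx'
  rw [map_add, map_zero, ← mul_apply_eq_comp, Units.inv_mul,
    one_apply_eq_self] at h1
  change -((A⁻¹ : (E →L[ℂ] E)ˣ) : E →L[ℂ] E) (K x) = x
  exact (eq_neg_of_add_eq_zero_left h1).symm

end CompactOperators

/-! ### Isolated points of finite multiplicity for bounded self-adjoint operators -/

section BoundedSelfAdjoint

variable {E : Type*} [NormedAddCommGroup E] [InnerProductSpace ℂ E] [CompleteSpace E]

/-- If `1 - ζ S` is invertible up to a compact operator, where `S` is self-adjoint, then its kernel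
has finite dimension, and `1 - ζ' S` is invertible for all `ζ' ≠ ζ` near `ζ`. -/
theorem isolated_of_isUnit_add_compact {S : E →L[ℂ] E} (hS : IsSelfAdjoint S) {ζ : ℂ}
    {K : E →L[ℂ] E} (hK : IsCompactOperator K) (hu : IsUnit (1 - ζ • S + K)) :
    FiniteDimensional ℂ (1 - ζ • S).ker ∧
    (∃ ε > 0, ∀ ζ' : ℂ, dist ζ' ζ < ε → ζ' ≠ ζ → IsUnit (1 - ζ' • S)) ∧
    ((1 - ζ • S).ker = ⊥ → IsUnit (1 - ζ • S)) := by
  have hKn : IsCompactOperator (-K) := hK.neg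
  have e0 : 1 - ζ • S + K + (-K) = 1 - ζ • S := by abel
  have hfin : FiniteDimensional ℂ (1 - ζ • S).ker := by
    have := finiteDimensional_ker_add hu hKn
    rwa [e0] at this
  have hbot : (1 - ζ • S).ker = ⊥ → IsUnit (1 - ζ • S) := fun h ↦ by
    have := isUnit_add_of_isCompactOperator hu hKn fun x hx ↦ by
      rw [e0] at hx
      exact (Submodule.eq_bot_iff _).1 h x hx
    rwa [e0] at this
  refine ⟨hfin, ?_, hbot⟩
  by_cases hN : (1 - ζ • S).ker = ⊥
  · have hopen : IsOpen {ζ' : ℂ | IsUnit (1 - ζ' • S)} :=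
      Units.isOpen.preimage (f := fun ζ' : ℂ ↦ (1 - ζ' • S : E →L[ℂ] E)) (by fun_prop)
    obtain ⟨ε, hε, hball⟩ := Metric.isOpen_iff.1 hopen ζ (hbot hN)
    exact ⟨ε, hε, fun ζ' h _ ↦ hball h⟩
  set N := (1 - ζ • S).ker with hNdef
  have memN : ∀ x, x ∈ N ↔ ζ • S x = x := fun x ↦ by
    rw [hNdef, LinearMap.mem_ker]
    change x - ζ • S x = 0 ↔ _
    rw [sub_eq_zero, eq_comm]
  obtain ⟨x₀, hx₀, hx₀0⟩ := (Submodule.ne_bot_iff _).1 hN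
  have hζ : ζ ≠ 0 := by
    rintro rfl
    exact hx₀0 (by simpa using ((memN x₀).1 hx₀).symm)
  have hsymm := hS.isSymmetric
  -- A nontrivial kernel makes `ζ⁻¹` an eigenvalue of a self-adjoint operator. Once ζ is real, the
  -- range of 1 - ζ S is orthogonal to its kernel `N`.
  have hreal : conj ζ = ζ := by
    have hev : Module.End.HasEigenvalue (S : E →ₗ[ℂ] E) ζ⁻¹ := by
      refine Module.End.hasEigenvalue_of_hasEigenvector (x := x₀) ⟨?_, hx₀0⟩
      rw [Module.End.mem_eigenspace_iff, eq_inv_smul_iff₀ hζ]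
      exact (memN x₀).1 hx₀
    have := hsymm.conj_eigenvalue_eq_self hev
    rw [map_inv₀] at this
    exact inv_injective this
  set P := N.starProjection with hPdef
  have hPN : ∀ x, P x ∈ N := fun x ↦ N.starProjection_apply_mem x
  have hSP : ∀ x, ζ • S (P x) = P x := fun x ↦ (memN _).1 (hPN x)
  have hort : ∀ x, ∀ y ∈ N, inner ℂ y (x - ζ • S x) = 0 := fun x y hy ↦ by
    have h1 : inner ℂ y (S x) = inner ℂ (S y) x := (hsymm y x).symm
    rw [inner_sub_right, inner_smul_right, h1]
    nth_rewrite 1 [← (memN y).1 hy]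
    rw [inner_smul_left, hreal, sub_self]
  have hPS : ∀ x, P (x - ζ • S x) = 0 := fun x ↦
    N.starProjection_apply_eq_zero_iff.2 (hort x)
  -- Adding the projection onto the kernel restores injectivity, and `P - K` is compact, so the
  -- alternative applies again.
  have hB : IsUnit (1 - ζ • S + P) := by
    have hKP : IsCompactOperator (P - K) := (isCompactOperator_starProjection N).sub hK
    have e1 : 1 - ζ • S + K + (P - K) = 1 - ζ • S + P := by abel
    have := isUnit_add_of_isCompactOperator hu hKP fun x hx ↦ ?_
    · rwa [e1] at this
    rw [e1] at hx
    have hx' : (x - ζ • S x) + P x = 0 := hx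
    have h1 : P (P x) = P x := N.starProjection_eq_self_iff.2 (hPN x)
    have h2 := congrArg P hx'
    rw [map_add, hPS, h1, zero_add, map_zero] at h2
    rw [h2, add_zero, sub_eq_zero] at hx'
    have h3 : P x = x := N.starProjection_eq_self_iff.2 ((memN x).2 hx'.symm)
    rw [← h3, h2]
  have hopen : IsOpen ({ζ' : ℂ | IsUnit (1 - ζ' • S + P)} ∩ {ζ' | 2 - ζ' / ζ ≠ 0}) :=
    (Units.isOpen.preimage (f := fun ζ' : ℂ ↦ (1 - ζ' • S + P : E →L[ℂ] E)) (by fun_prop)).inter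
      (isOpen_ne_fun (by fun_prop) continuous_const)
  obtain ⟨ε, hε, hball⟩ := Metric.isOpen_iff.1 hopen ζ ⟨hB, by
    simp only [Set.mem_ofPred_eq, div_self hζ]; norm_num⟩
  refine ⟨ε, hε, fun ζ' hd hne ↦ ?_⟩
  obtain ⟨hu', h2⟩ := hball hd
  simp only [Set.mem_ofPred_eq] at hu' h2
  -- On `N` the operator 1 - ζ' S + P is the scalar `b`. Removing `P` multiplies it there by (b - 1)
  -- / b, which is nonzero exactly because ζ' ≠ ζ.
  set b := 2 - ζ' / ζ with hb
  have hb1 : b - 1 ≠ 0 := by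
    rw [hb]
    intro h
    apply hne
    field_simp at h
    linear_combination -h
  have hPP : P * P = P := by
    ext x
    exact N.starProjection_eq_self_iff.2 (hPN x)
  have hSP' : S * P = ζ⁻¹ • P := by
    ext x
    change S (P x) = ζ⁻¹ • P x
    rw [eq_inv_smul_iff₀ hζ]
    exact hSP x
  have e2 : 1 - ζ' • S = (1 - ζ' • S + P) * (1 - b⁻¹ • P) := by
    have e3 : (1 - ζ' • S + P) * P = b • P := by
      rw [add_mul, sub_mul, one_mul, smul_mul_assoc, hSP', hPP, smul_smul, hb]
      module
    rw [mul_sub, mul_one, mul_smul_comm, e3, smul_smul, inv_mul_cancel₀ h2, one_smul]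
    abel
  rw [e2]
  have e5 : -b⁻¹ + (b - 1)⁻¹ - b⁻¹ * (b - 1)⁻¹ = 0 := by
    field_simp
    ring
  have e4 : (1 - b⁻¹ • P) * (1 + (b - 1)⁻¹ • P)
      = 1 + (-b⁻¹ + (b - 1)⁻¹ - b⁻¹ * (b - 1)⁻¹) • P := by
    simp only [mul_add, sub_mul, mul_one, one_mul, smul_mul_assoc, mul_smul_comm, hPP]
    module
  have e6 : (1 + (b - 1)⁻¹ • P) * (1 - b⁻¹ • P)
      = 1 + (-b⁻¹ + (b - 1)⁻¹ - b⁻¹ * (b - 1)⁻¹) • P := by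
    simp only [mul_sub, add_mul, mul_one, one_mul, smul_mul_assoc, mul_smul_comm, hPP]
    module
  rw [e5, zero_smul, add_zero] at e4 e6
  exact hu'.mul ⟨⟨_, _, e4, e6⟩, rfl⟩

/-- If `S` is self-adjoint, `1 - ζ S` has finite dimensional kernel, and `1 - ζ' S` is invertible for
all `ζ' ≠ ζ` near `ζ`, then `1 - ζ S` is invertible up to a compact operator. -/
theorem exists_compact_isUnit_of_isolated {S : E →L[ℂ] E} (hS : IsSelfAdjoint S) {ζ : ℂ}
    (hfin : FiniteDimensional ℂ (1 - ζ • S).ker)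
    (hiso : ∃ ε > 0, ∀ ζ' : ℂ, dist ζ' ζ < ε → ζ' ≠ ζ → IsUnit (1 - ζ' • S)) :
    ∃ K : E →L[ℂ] E, IsCompactOperator K ∧ IsUnit (1 - ζ • S + K) := by
  by_cases hζ : ζ = 0
  · exact ⟨0, isCompactOperator_zero, by simp [hζ]⟩
  obtain ⟨ε, hε, hiso⟩ := hiso
  have hnormal : IsStarNormal S := hS.isStarNormal
  have hnear : ∀ᶠ w in nhds ζ⁻¹, w ∈ spectrum ℂ S → w = ζ⁻¹ := by
    have h1 : ∀ᶠ w in nhds ζ⁻¹, w ≠ 0 := eventually_ne_nhds (inv_ne_zero hζ)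
    have h2 : ∀ᶠ w in nhds ζ⁻¹, dist w⁻¹ ζ < ε := by
      have : Filter.Tendsto (fun w : ℂ ↦ w⁻¹) (nhds ζ⁻¹) (nhds ζ) := by
        simpa using (continuousAt_inv₀ (inv_ne_zero hζ)).tendsto
      exact this.eventually (Metric.ball_mem_nhds ζ hε)
    filter_upwards [h1, h2] with w hw hd hspec
    by_contra hne
    have hu := hiso w⁻¹ hd (fun h ↦ hne (by rw [← h, inv_inv]))
    refine hspec ?_
    rw [spectrum.mem_resolventSet_iff]
    have : algebraMap ℂ (E →L[ℂ] E) w - S = algebraMap ℂ (E →L[ℂ] E) w * (1 - w⁻¹ • S) := by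
      rw [mul_sub, mul_one, mul_smul_comm, ← Algebra.smul_def, smul_smul, inv_mul_cancel₀ hw,
        one_smul]
    rw [this]
    exact ((IsUnit.mk0 w hw).map _).mul hu
  classical
  -- The indicator of `ζ⁻¹` is continuous on the spectrum because no other spectral point is near.
  -- Then `cfc f S` is the spectral projection: its range lies in the finite dimensional kernel, and
  -- 1 - ζ w + f w has no zero.
  set f : ℂ → ℂ := fun w ↦ if w = ζ⁻¹ then 1 else 0 with hf
  have hfc : ContinuousOn f (spectrum ℂ S) := by
    intro w hw
    by_cases h : w = ζ⁻¹
    · subst h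
      refine (continuousWithinAt_const (b := (1 : ℂ))).congr_of_eventuallyEq ?_ (by simp [hf])
      filter_upwards [nhdsWithin_le_nhds hnear, self_mem_nhdsWithin] with x hx hxs
      simp [hf, hx hxs]
    · refine (continuousWithinAt_const (b := (0 : ℂ))).congr_of_eventuallyEq ?_ (by simp [hf, h])
      filter_upwards [nhdsWithin_le_nhds (eventually_ne_nhds h)] with x hx
      simp [hf, hx]
  have hlin : cfc (fun w : ℂ ↦ 1 - ζ * w) S = 1 - ζ • S := by
    rw [cfc_sub (fun _ ↦ (1 : ℂ)) (fun w ↦ ζ * w) S, cfc_const_one ℂ S, cfc_const_mul ζ (fun w ↦ w) S,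
      cfc_id' ℂ S]
  have hzero : (1 - ζ • S) * cfc f S = 0 := by
    rw [← hlin, ← cfc_mul (fun w : ℂ ↦ 1 - ζ * w) f S]
    have : (fun w : ℂ ↦ (1 - ζ * w) * f w) = fun _ ↦ 0 := by
      funext w
      by_cases h : w = ζ⁻¹
      · simp [h, hζ]
      · simp [hf, h]
    rw [this, cfc_const_zero]
  refine ⟨cfc f S, ?_, ?_⟩
  · have hmem : ∀ x, cfc f S x ∈ (1 - ζ • S).ker := fun x ↦ by
      have := congrArg (fun A : E →L[ℂ] E ↦ A x) hzero
      exact this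
    have h1 : IsCompactOperator ((cfc f S).codRestrict _ hmem) :=
      isCompactOperator_of_locallyCompactSpace_dom
        ((cfc f S).codRestrict _ hmem)
    exact h1.clm_comp (1 - ζ • S).ker.subtypeL
  · rw [← hlin, ← cfc_add (a := S) (fun w : ℂ ↦ 1 - ζ * w) f]
    refine isUnit_cfc _ S (by fun_prop) inferInstance fun w _ ↦ ?_
    by_cases h : w = ζ⁻¹
    · simp [hf, h, hζ]
    · simp only [hf, h, if_false, add_zero]
      intro h0
      exact h (eq_inv_of_mul_eq_one_right (by linear_combination -h0))

end BoundedSelfAdjoint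

/-! ### From an unbounded operator to its resolvent at -1; Weyl's theorem -/

section Unbounded

variable {E : Type*} [NormedAddCommGroup E] [InnerProductSpace ℂ E]

/-- `S` is the resolvent `(T + 1)⁻¹`. -/
def IsShiftedInverse (T : E →ₗ.[ℂ] E) (S : E →L[ℂ] E) : Prop :=
  ∀ u f : E, (u, f) ∈ T.graph ↔ u = S (f + u)

variable {T : E →ₗ.[ℂ] E} {S : E →L[ℂ] E}

theorem IsShiftedInverse.apply_domain (h : IsShiftedInverse T S) (u : T.domain) :
    S (T u + u) = u :=
  ((h u (T u)).1 (T.mem_graph u)).symm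

theorem IsShiftedInverse.exists_domain (h : IsShiftedInverse T S) (f : E) :
    ∃ u : T.domain, (u : E) = S f ∧ T u = f - S f := by
  obtain ⟨u, hu, hT⟩ := T.mem_graph_iff.1 ((h (S f) (f - S f)).2 (by simp))
  exact ⟨u, hu, hT⟩

/-- Since T - z = (T + 1) - (z + 1), one has (T - z) S = 1 - (z + 1) S. A resolvent R at z yields
the inverse 1 + (z + 1) R, and an inverse V⁻¹ yields the resolvent S V⁻¹. -/
theorem IsShiftedInverse.inResolventSet_iff (h : IsShiftedInverse T S) (z : ℂ) :
    InResolventSet T z ↔ IsUnit (1 - (z + 1) • S) := by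
  constructor
  · rintro ⟨R, hR1, hR2⟩
    have e1 : (1 - (z + 1) • S) * (1 + (z + 1) • R) = 1 := by
      ext f
      obtain ⟨u, hu, hT⟩ := hR2 f
      have h1 := h.apply_domain u
      rw [eq_add_of_sub_eq hT, hu] at h1
      have h2 : S f + (z + 1) • S (R f) = R f := by
        have h3 : f + z • R f + R f = f + (z + 1) • R f := by module
        rw [h3, map_add, map_smul] at h1
        exact h1
      change (f + (z + 1) • R f) - (z + 1) • S (f + (z + 1) • R f) = f
      rw [map_add, map_smul, h2]
      abel
    have e2 : (1 + (z + 1) • R) * (1 - (z + 1) • S) = 1 := by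
      ext f
      obtain ⟨u, hu, hT⟩ := h.exists_domain f
      have h1 := hR1 u
      rw [hT, hu] at h1
      have h2 : f - S f - z • S f = f - (z + 1) • S f := by module
      rw [h2] at h1
      change (f - (z + 1) • S f) + (z + 1) • R (f - (z + 1) • S f) = f
      rw [h1]
      abel
    exact ⟨⟨_, _, e1, e2⟩, rfl⟩
  · rintro ⟨V, hV⟩
    have e1 : ∀ f, ((V⁻¹ : (E →L[ℂ] E)ˣ) : E →L[ℂ] E) (f - (z + 1) • S f) = f := fun f ↦ by
      have := congrArg (fun A : E →L[ℂ] E ↦ A f) V.inv_mul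
      simpa [hV] using this
    have e2 : ∀ f, ((V⁻¹ : (E →L[ℂ] E)ˣ) : E →L[ℂ] E) f
        - (z + 1) • S (((V⁻¹ : (E →L[ℂ] E)ˣ) : E →L[ℂ] E) f) = f := fun f ↦ by
      have := congrArg (fun A : E →L[ℂ] E ↦ A f) V.mul_inv
      simpa [hV] using this
    refine ⟨S ∘L ((V⁻¹ : (E →L[ℂ] E)ˣ) : E →L[ℂ] E), fun u ↦ ?_, fun f ↦ ?_⟩
    · have h1 := h.apply_domain u
      have h2 : T u - z • (u : E) = (T u + u) - (z + 1) • S (T u + u) := by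
        rw [h1]
        module
      rw [h2, ContinuousLinearMap.comp_apply, e1, h1]
    · obtain ⟨u, hu, hT⟩ := h.exists_domain (((V⁻¹ : (E →L[ℂ] E)ˣ) : E →L[ℂ] E) f)
      refine ⟨u, hu, ?_⟩
      rw [hT, hu]
      conv_rhs => rw [← e2 f]
      module

theorem IsShiftedInverse.eigenspace_eq (h : IsShiftedInverse T S) (z : ℂ) :
    eigenspace T z = (1 - (z + 1) • S).ker := by
  ext u
  change (u, z • u) ∈ T.graph ↔ u - (z + 1) • S u = 0
  rw [h, sub_eq_zero, ← map_smul, add_smul, one_smul]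

/-- The complement of the essential spectrum consists of the points where `1 - (z + 1) S` is
invertible up to a compact operator. -/
theorem IsShiftedInverse.notMem_essSpec_iff [CompleteSpace E] (h : IsShiftedInverse T S)
    (hS : IsSelfAdjoint S) (z : ℂ) :
    z ∉ essSpec T ↔ ∃ K : E →L[ℂ] E, IsCompactOperator K ∧ IsUnit (1 - (z + 1) • S + K) := by
  have key : z ∉ essSpec T ↔ InResolventSet T z ∨ z ∈ discreteSpec T := by
    simp only [essSpec, spec, Set.mem_sdiff, Set.mem_ofPred_eq]
    tauto
  rw [key, h.inResolventSet_iff]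
  constructor
  · rintro (hu | ⟨-, hfin, ε, hε, hiso⟩)
    · exact ⟨0, isCompactOperator_zero, by simpa using hu⟩
    · rw [h.eigenspace_eq] at hfin
      refine exists_compact_isUnit_of_isolated hS hfin ⟨ε, hε, fun ζ' hd hne ↦ ?_⟩
      by_contra hu
      have h1 : ζ' - 1 ∈ spec T := by
        change ¬ InResolventSet T (ζ' - 1)
        rwa [h.inResolventSet_iff, sub_add_cancel]
      have h2 := hiso _ h1 (fun e ↦ hne (by rw [← e, sub_add_cancel]))
      have h3 : dist (ζ' - 1) z = dist ζ' (z + 1) := by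
        rw [dist_eq_norm, dist_eq_norm]
        congr 1
        ring
      rw [h3] at h2
      exact absurd hd (not_lt.2 h2)
  · rintro ⟨K, hK, hu⟩
    obtain ⟨hfin, ⟨ε, hε, hiso⟩, hbot⟩ := isolated_of_isUnit_add_compact hS hK hu
    -- A trivial kernel puts z in the resolvent set, a nontrivial one in the discrete spectrum.
    by_cases hN : (1 - (z + 1) • S).ker = ⊥
    · exact Or.inl (hbot hN)
    · refine Or.inr ⟨by rwa [h.eigenspace_eq], by rwa [h.eigenspace_eq], ε, hε, fun w hw hne ↦ ?_⟩
      by_contra hd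
      refine hw ((h.inResolventSet_iff w).2 (hiso (w + 1) ?_ (fun e ↦ hne (add_right_cancel e))))
      rw [dist_add_right]
      exact not_le.1 hd

/-- Weyl's theorem: the essential spectrum is stable under compact perturbations of the
resolvent. -/
theorem essSpec_eq_of_isCompactOperator_sub [CompleteSpace E] {T₁ T₂ : E →ₗ.[ℂ] E}
    {S₁ S₂ : E →L[ℂ] E} (h₁ : IsShiftedInverse T₁ S₁) (h₂ : IsShiftedInverse T₂ S₂)
    (hS₁ : IsSelfAdjoint S₁) (hS₂ : IsSelfAdjoint S₂) (hc : IsCompactOperator (S₁ - S₂)) :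
    essSpec T₁ = essSpec T₂ := by
  ext z
  rw [← not_iff_not, h₁.notMem_essSpec_iff hS₁, h₂.notMem_essSpec_iff hS₂]
  constructor
  · rintro ⟨K, hK, hu⟩
    refine ⟨K - (z + 1) • (S₁ - S₂), hK.sub (hc.smul (z + 1)), ?_⟩
    convert! hu using 1
    module
  · rintro ⟨K, hK, hu⟩
    refine ⟨K + (z + 1) • (S₁ - S₂), hK.add (hc.smul (z + 1)), ?_⟩
    convert! hu using 1
    module

/-- The domain is the range of the injective symmetric operator `S`, hence dense. Symmetry of `S`
then shows that (y, g) is in the graph of the adjoint iff y = S (g + y), which is the graph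
condition for `T`. -/
theorem IsShiftedInverse.isSelfAdjoint [CompleteSpace E] (h : IsShiftedInverse T S)
    (hS : IsSelfAdjoint S) : IsSelfAdjoint T := by
  have hsymm := hS.isSymmetric
  have hinj : ∀ f, S f = 0 → f = 0 := fun f hf ↦ by
    obtain ⟨u, hu, hT⟩ := h.exists_domain f
    obtain rfl : u = 0 := Subtype.ext (by rw [hu, hf]; rfl)
    rw [hf, sub_zero] at hT
    rw [← hT]
    exact T.map_zero
  have hdense : Dense (T.domain : Set E) := by
    rw [Submodule.dense_iff_topologicalClosure_eq_top, Submodule.topologicalClosure_eq_top_iff,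
      Submodule.eq_bot_iff]
    intro x hx
    refine hinj x (ext_inner_left ℂ fun f ↦ ?_)
    obtain ⟨u, hu, -⟩ := h.exists_domain f
    have h1 : inner ℂ (S f) x = 0 := by
      rw [← hu]
      exact hx u u.2
    rw [inner_zero_right, ← h1]
    exact (hsymm f x).symm
  rw [LinearPMap.isSelfAdjoint_def]
  refine LinearPMap.eq_of_eq_graph ?_
  rw [LinearPMap.adjoint_graph_eq_graph_adjoint hdense]
  ext ⟨y, g⟩
  rw [Submodule.mem_adjoint_iff, h]
  constructor
  · intro hy
    refine ext_inner_left ℂ fun f ↦ ?_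
    have h1 := hy (S f) (f - S f) ((h _ _).2 (by simp))
    have h2 : inner ℂ (S f) (g + y) = inner ℂ f (S (g + y)) := hsymm f (g + y)
    rw [← h2, inner_add_right]
    rw [inner_sub_left] at h1
    linear_combination h1
  · intro hy a b hab
    have ha := (h a b).1 hab
    have h2 : inner ℂ (S (b + a)) (g + y) = inner ℂ (b + a) (S (g + y)) := hsymm _ _
    rw [← ha, ← hy, inner_add_right, inner_add_left] at h2
    change inner ℂ b y - inner ℂ a g = 0
    linear_combination -h2

end Unbounded

/-! ### Coercive forms and compactness of resolvent differences -/

section AbstractForm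

open ContinuousLinearMap

variable {H L F : Type*} [NormedAddCommGroup H] [InnerProductSpace ℂ H] [CompleteSpace H]
  [NormedAddCommGroup L] [InnerProductSpace ℂ L] [CompleteSpace L]
  [NormedAddCommGroup F] [InnerProductSpace ℂ F] [CompleteSpace F]
  (J : H →L[ℂ] L) (G : H →L[ℂ] F) (M : F →L[ℂ] F)

/-- The operator on the form domain which represents the form `⟨G v, M G w⟩ + ⟨J v, J w⟩`. -/
def formOp : H →L[ℂ] H := adjoint J ∘L J + adjoint G ∘L M ∘L G

/-- The solution operator: `w = solOp f` satisfies `⟨G v, M G w⟩ + ⟨J v, J w⟩ = ⟨J v, f⟩`. -/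
def solOp : L →L[ℂ] H := Ring.inverse (formOp J G M) ∘L adjoint J

/-- The resolvent at `-1` of the operator associated with the form. -/
def resolventOp : L →L[ℂ] L := J ∘L solOp J G M

variable {J G M}

theorem inner_formOp (v w : H) :
    inner ℂ v (formOp J G M w) = inner ℂ (J v) (J w) + inner ℂ (G v) (M (G w)) := by
  simp [formOp, adjoint_inner_right]

/-- Lax–Milgram: the form is coercive with constant `min 1 ν`, the 1 coming from the L² part and ν
from the gradient part. -/
theorem isUnit_formOp {ν : ℝ} (hν : 0 < ν) (hnorm : ∀ w, ‖w‖ ^ 2 = ‖J w‖ ^ 2 + ‖G w‖ ^ 2)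
    (hM : ∀ g, ν * ‖g‖ ^ 2 ≤ (inner ℂ g (M g)).re) : IsUnit (formOp J G M) := by
  have hc : 0 < min 1 ν := lt_min one_pos hν
  refine isUnit_of_forall_le_norm_inner_map _ (c := ⟨min 1 ν, hc.le⟩) hc fun w ↦ ?_
  rw [norm_inner_symm, inner_formOp]
  refine le_trans ?_ (Complex.re_le_norm _)
  have h1 : (inner ℂ (J w) (J w)).re = ‖J w‖ ^ 2 := by
    have := inner_self_eq_norm_sq (𝕜 := ℂ) (J w)
    exact this
  rw [Complex.add_re, h1]
  have h2 := hM (G w)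
  change ‖w‖ ^ 2 * min 1 ν ≤ _
  rw [hnorm]
  nlinarith [min_le_left 1 ν, min_le_right 1 ν, sq_nonneg ‖J w‖, sq_nonneg ‖G w‖]

theorem isSelfAdjoint_formOp (hM : IsSelfAdjoint M) : IsSelfAdjoint (formOp J G M) := by
  rw [isSelfAdjoint_iff_isSymmetric]
  intro v w
  have h1 := inner_formOp (J := J) (G := G) (M := M) v w
  have h2 := inner_formOp (J := J) (G := G) (M := M) w v
  have h3 : inner ℂ (M (G v)) (G w) = inner ℂ (G v) (M (G w)) := hM.isSymmetric _ _
  change inner ℂ (formOp J G M v) w = inner ℂ v (formOp J G M w)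
  rw [← inner_conj_symm, h2, h1, map_add, inner_conj_symm, inner_conj_symm, h3]

theorem formOp_solOp (hB : IsUnit (formOp J G M)) : formOp J G M ∘L solOp J G M = adjoint J := by
  rw [solOp, ← comp_assoc]
  change (formOp J G M * Ring.inverse (formOp J G M)) ∘L adjoint J = adjoint J
  rw [Ring.mul_inverse_cancel _ hB]
  rfl

/-- The operator has the shape J B⁻¹ J* with B self-adjoint. -/
theorem isSelfAdjoint_resolventOp (hM : IsSelfAdjoint M) :
    IsSelfAdjoint (resolventOp J G M) := by
  have hB' := isSelfAdjoint_formOp (J := J) (G := G) hM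
  have hinv : IsSelfAdjoint (Ring.inverse (formOp J G M)) := by
    rw [isSelfAdjoint_iff, ← Ring.inverse_star, hB'.star_eq]
  exact hinv.conj_adjoint J

/-- `w = solOp f` is the only solution of `⟨G v, M G w⟩ + ⟨J v, J w⟩ = ⟨J v, f⟩`. -/
theorem eq_solOp_iff (hB : IsUnit (formOp J G M)) (w : H) (f : L) :
    w = solOp J G M f ↔
      ∀ v, inner ℂ (J v) (J w) + inner ℂ (G v) (M (G w)) = inner ℂ (J v) f := by
  have h1 : formOp J G M (solOp J G M f) = adjoint J f :=
    congrArg (fun A : L →L[ℂ] H ↦ A f) (formOp_solOp hB)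
  constructor
  · rintro rfl v
    rw [← inner_formOp, h1, adjoint_inner_right]
  · intro h
    refine ((isUnit_iff_bijective.1 hB).1) (ext_inner_left ℂ fun v ↦ ?_)
    rw [h1, inner_formOp, h, adjoint_inner_right]

/-- Two forms which differ by a perturbation supported where a cutoff equals one have resolvents
with compact difference, if the cutoff and its commutator with `G` are compact relative to the
form domain. -/
theorem isCompactOperator_resolventOp_sub {M₁ M₂ : F →L[ℂ] F} {m : H →L[ℂ] H} {θ : L →L[ℂ] L}
    {Θ : F →L[ℂ] F} {R : H →L[ℂ] F} (hB₁ : IsUnit (formOp J G M₁)) (hB₂ : IsUnit (formOp J G M₂))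
    (hJm : J ∘L m = θ ∘L J) (hGm : G ∘L m = Θ ∘L G + R) (hθ : IsSelfAdjoint θ)
    (hΘ : IsSelfAdjoint Θ) (hθJ : IsCompactOperator (θ ∘L J)) (hR : IsCompactOperator R)
    (hcomm : M₂ ∘L Θ = Θ ∘L M₂) (hsub : (M₂ - M₁) ∘L Θ = M₂ - M₁) :
    IsCompactOperator (resolventOp J G M₁ - resolventOp J G M₂) := by
  have hθ' : adjoint θ = θ := hθ.adjoint_eq
  have hΘ' : adjoint Θ = Θ := hΘ.adjoint_eq
  set W := solOp J G M₂ with hW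
  have hJm' : adjoint m ∘L adjoint J = adjoint J ∘L θ := by
    rw [← adjoint_comp, hJm, adjoint_comp, hθ']
  have hGm' : adjoint m ∘L adjoint G = adjoint G ∘L Θ + adjoint R := by
    rw [← adjoint_comp, hGm, map_add, adjoint_comp, hΘ']
  have e1 : formOp J G M₂ ∘L m ∘L W = adjoint (θ ∘L J) + adjoint G ∘L M₂ ∘L R ∘L W
      - adjoint R ∘L M₂ ∘L G ∘L W := by
    have h1 : adjoint m ∘L formOp J G M₂ ∘L W = adjoint (θ ∘L J) := by
      rw [hW, formOp_solOp hB₂, ← adjoint_comp, hJm]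
    -- Since θ and Θ are self-adjoint and `M₂` commutes with Θ, the leading terms of B₂ m and m* B₂
    -- coincide; only terms containing `R` survive.
    have h2 : formOp J G M₂ ∘L m = adjoint m ∘L formOp J G M₂ + adjoint G ∘L M₂ ∘L R
        - adjoint R ∘L M₂ ∘L G := by
      have h3 : adjoint m ∘L formOp J G M₂ = adjoint J ∘L θ ∘L J + adjoint G ∘L Θ ∘L M₂ ∘L G
          + adjoint R ∘L M₂ ∘L G := by
        rw [formOp, comp_add, ← comp_assoc, hJm', ← comp_assoc, hGm', add_comp]
        simp only [comp_assoc, add_assoc]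
      have h4 : formOp J G M₂ ∘L m = adjoint J ∘L θ ∘L J + adjoint G ∘L Θ ∘L M₂ ∘L G
          + adjoint G ∘L M₂ ∘L R := by
        rw [formOp, add_comp, comp_assoc, hJm, comp_assoc, comp_assoc, hGm, comp_add, comp_add,
          ← comp_assoc M₂ Θ G, hcomm]
        simp only [comp_assoc, add_assoc]
      rw [h3, h4]
      abel
    rw [← comp_assoc, h2, sub_comp, add_comp, comp_assoc, h1]
    simp only [comp_assoc]
  have c1 : IsCompactOperator (formOp J G M₂ ∘L m ∘L W) := by
    rw [e1]
    exact ((isCompactOperator_adjoint hθJ).add ((hR.comp_clm W).clm_comp (adjoint G ∘L M₂))).sub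
      ((isCompactOperator_adjoint hR).comp_clm (M₂ ∘L G ∘L W))
  -- Inverting B₂ gives compactness in the norm of the form domain, hence control of gradients.
  have c2 : IsCompactOperator (m ∘L W) := by
    have h1 : m ∘L W = Ring.inverse (formOp J G M₂) ∘L formOp J G M₂ ∘L m ∘L W := by
      rw [← comp_assoc]
      change m ∘L W = (Ring.inverse (formOp J G M₂) * formOp J G M₂) ∘L m ∘L W
      rw [Ring.inverse_mul_cancel _ hB₂]
      rfl
    rw [h1]
    exact c1.clm_comp _
  have c3 : IsCompactOperator (Θ ∘L G ∘L W) := by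
    have h1 : Θ ∘L G ∘L W = G ∘L m ∘L W - R ∘L W := by
      rw [← comp_assoc, ← comp_assoc, hGm, add_comp, add_sub_cancel_right]
    rw [h1]
    exact (c2.clm_comp G).sub (hR.comp_clm W)
  -- Second resolvent identity, with Θ inserted behind M₂ - M₁ at no cost by `hsub`.
  have e2 : resolventOp J G M₁ - resolventOp J G M₂ =
      (J ∘L Ring.inverse (formOp J G M₁) ∘L adjoint G ∘L (M₂ - M₁)) ∘L (Θ ∘L G ∘L W) := by
    have h1 : formOp J G M₂ ∘L W = adjoint J := formOp_solOp hB₂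
    have h2 : formOp J G M₂ - formOp J G M₁ = adjoint G ∘L (M₂ - M₁) ∘L G := by
      simp only [formOp, sub_comp, comp_sub]
      abel
    have h3 : Ring.inverse (formOp J G M₁) ∘L (formOp J G M₂ - formOp J G M₁) ∘L W
        = solOp J G M₁ - W := by
      rw [sub_comp, comp_sub, h1, ← comp_assoc]
      change _ - (Ring.inverse (formOp J G M₁) * formOp J G M₁) ∘L W = _
      rw [Ring.inverse_mul_cancel _ hB₁]
      rfl
    rw [resolventOp, resolventOp, ← comp_sub, ← hW, ← h3, h2]
    have h4 : (M₂ - M₁) ∘L Θ ∘L G ∘L W = (M₂ - M₁) ∘L G ∘L W := by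
      rw [← comp_assoc (M₂ - M₁) Θ (G ∘L W), hsub]
    simp only [comp_assoc, h4]
  rw [e2]
  exact c3.clm_comp (J ∘L Ring.inverse (formOp J G M₁) ∘L adjoint G ∘L (M₂ - M₁))

end AbstractForm

/-! ### Translation estimate for functions with a weak gradient -/

section Translation

variable {d : ℕ}

theorem coeFn_testL2 {φ : EuclideanSpace ℝ (Fin d) → ℝ} (hφ : ContDiff ℝ ∞ φ)
    (hs : HasCompactSupport φ) : testL2 hφ hs =ᵐ[volume] fun x ↦ (φ x : ℂ) :=
  (memLp_testFunction hφ.continuous hs).ofReal (K := ℂ).coeFn_toLp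

theorem inner_testL2 {φ : EuclideanSpace ℝ (Fin d) → ℝ} (hφ : ContDiff ℝ ∞ φ)
    (hs : HasCompactSupport φ) (f : L2 d) : inner ℂ (testL2 hφ hs) f = ∫ x, φ x • f x := by
  rw [L2.inner_def]
  refine integral_congr_ae ?_
  filter_upwards [coeFn_testL2 hφ hs] with x hx
  rw [hx]
  simp [mul_comm]

theorem hasCompactSupport_comp_sub {φ : EuclideanSpace ℝ (Fin d) → ℝ}
    (hs : HasCompactSupport φ) (y : EuclideanSpace ℝ (Fin d)) :
    HasCompactSupport fun x ↦ φ (x - y) :=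
  hs.comp_homeomorph (Homeomorph.subRight y)

theorem norm_testL2_comp_sub {φ : EuclideanSpace ℝ (Fin d) → ℝ} (hφ : ContDiff ℝ ∞ φ)
    (hs : HasCompactSupport φ) (y : EuclideanSpace ℝ (Fin d))
    (hφ' : ContDiff ℝ ∞ fun x ↦ φ (x - y)) :
    ‖testL2 hφ' (hasCompactSupport_comp_sub hs y)‖ = ‖testL2 hφ hs‖ := by
  rw [testL2, testL2, Lp.norm_toLp, Lp.norm_toLp]
  congr 1
  exact eLpNorm_comp_measurePreserving (g := fun x ↦ (φ x : ℂ))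
    ((memLp_testFunction hφ.continuous hs).ofReal (K := ℂ)).aestronglyMeasurable
    (measurePreserving_sub_right volume y)

/-- The complex functional `z ↦ ∑ hᵢ zᵢ` for a real vector `h`. -/
def realPairing (h : EuclideanSpace ℝ (Fin d)) : EuclideanSpace ℂ (Fin d) →L[ℂ] ℂ :=
  innerSL ℂ (WithLp.toLp 2 fun i ↦ (h i : ℂ) : EuclideanSpace ℂ (Fin d))

theorem realPairing_apply (h : EuclideanSpace ℝ (Fin d)) (z : EuclideanSpace ℂ (Fin d)) :
    realPairing h z = ∑ i, (h i : ℂ) * z i := by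
  simp [realPairing, PiLp.inner_apply, mul_comm]

theorem norm_realPairing (h : EuclideanSpace ℝ (Fin d)) : ‖realPairing h‖ = ‖h‖ := by
  rw [realPairing, innerSL_apply_norm, EuclideanSpace.norm_eq, EuclideanSpace.norm_eq]
  simp

/-- The weak gradient gives all directional derivatives. -/
theorem HasWeakGradient.integral_fderiv {u : L2 d} {g : L2Field d} (hug : HasWeakGradient u g)
    {φ : EuclideanSpace ℝ (Fin d) → ℝ} (hφ : ContDiff ℝ ∞ φ) (hs : HasCompactSupport φ)
    (h : EuclideanSpace ℝ (Fin d)) :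
    ∫ x, fderiv ℝ φ x h • u x = - ∫ x, φ x • realPairing h (g x) := by
  have e1 : ∀ x, fderiv ℝ φ x h • u x = ∑ i, (h i : ℂ) * (partialDeriv i φ x • u x) := fun x ↦ by
    have h1 : h = ∑ i, h i • EuclideanSpace.single i (1 : ℝ) := by
      ext j
      simp [Finset.sum_apply, Pi.single_apply]
    conv_lhs => rw [h1]
    rw [map_sum, Finset.sum_smul]
    refine Finset.sum_congr rfl fun i _ ↦ ?_
    rw [map_smul, partialDeriv]
    simp only [smul_eq_mul, Complex.real_smul, Complex.ofReal_mul]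
    ring
  have e2 : ∀ x, φ x • realPairing h (g x) = ∑ i, (h i : ℂ) * (φ x • g x i) := fun x ↦ by
    rw [realPairing_apply, Finset.smul_sum]
    refine Finset.sum_congr rfl fun i _ ↦ ?_
    simp only [Complex.real_smul]
    ring
  simp only [e1, e2]
  have mφ := memLp_testFunction hφ.continuous hs
  rw [integral_finsetSum _ fun i _ ↦ ((integrable_smul (memLp_testFunction
      (continuous_partialDeriv hφ i) (hasCompactSupport_partialDeriv hs i))
      (Lp.memLp u)).const_mul _),
    integral_finsetSum _ fun i _ ↦ ((integrable_smul mφ (memLp_coord g i)).const_mul _),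
    ← Finset.sum_neg_distrib]
  refine Finset.sum_congr rfl fun i _ ↦ ?_
  rw [integral_const_mul, integral_const_mul, hug φ hφ hs i]
  ring

theorem norm_integral_smul_le {φ : EuclideanSpace ℝ (Fin d) → ℝ} (hφ : ContDiff ℝ ∞ φ)
    (hs : HasCompactSupport φ) (h : EuclideanSpace ℝ (Fin d)) (g : L2Field d) :
    ‖∫ x, φ x • realPairing h (g x)‖ ≤ ‖testL2 hφ hs‖ * (‖h‖ * ‖g‖) := by
  have e : ∫ x, φ x • realPairing h (g x)
      = inner ℂ (testL2 hφ hs) ((realPairing h).compLp g) := by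
    rw [inner_testL2]
    refine integral_congr_ae ?_
    filter_upwards [(realPairing h).coeFn_compLp g] with x hx
    rw [hx]
  rw [e, ← norm_realPairing h]
  exact (norm_inner_le_norm _ _).trans
    (mul_le_mul_of_nonneg_left ((realPairing h).norm_compLp_le g) (norm_nonneg _))

/-- The pairing with a translated test function is differentiable in the translation. -/
theorem HasWeakGradient.hasFDerivAt_translate {u : L2 d} {g : L2Field d}
    (hug : HasWeakGradient u g) {φ : EuclideanSpace ℝ (Fin d) → ℝ} (hφ : ContDiff ℝ ∞ φ)
    (hs : HasCompactSupport φ) (y : EuclideanSpace ℝ (Fin d)) :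
    ∃ D : EuclideanSpace ℝ (Fin d) →L[ℝ] ℂ,
      HasFDerivAt (fun y ↦ ∫ x, φ (x - y) • u x) D y ∧ ‖D‖ ≤ ‖testL2 hφ hs‖ * ‖g‖ := by
  -- Reflection turns the pairing into a convolution with u, so differentiability in y needs
  -- smoothness of the test function only.
  set ψ : EuclideanSpace ℝ (Fin d) → ℝ := fun x ↦ φ (-x) with hψ
  have hψc : ContDiff ℝ ∞ ψ := hφ.comp contDiff_neg
  have hψs : HasCompactSupport ψ := hs.comp_homeomorph (Homeomorph.neg _)
  set L : ℂ →L[ℝ] ℝ →L[ℝ] ℂ := (ContinuousLinearMap.lsmul ℝ ℝ).flip with hL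
  have hu : LocallyIntegrable (fun x ↦ u x) := (Lp.memLp u).locallyIntegrable (by norm_num)
  have hd := hψs.hasFDerivAt_convolution_right L hu (hψc.of_le (by simp)) y (μ := volume)
  have e1 : (MeasureTheory.convolution (fun x ↦ u x) ψ L volume)
      = fun y ↦ ∫ x, φ (x - y) • u x := by
    funext y
    simp [convolution_def, hL, hψ]
  rw [e1] at hd
  refine ⟨_, hd, ContinuousLinearMap.opNorm_le_bound _ (by positivity) fun h ↦ ?_⟩
  rw [convolution_precompR_apply L hu (hψs.fderiv ℝ) (hψc.continuous_fderiv (by simp))]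
  have hφ' : ContDiff ℝ ∞ fun x ↦ φ (x - y) := hφ.comp (contDiff_id.sub contDiff_const)
  -- Integration by parts moves the derivative onto u. The resulting bound does not depend on y, as
  -- translations preserve the L² norm.
  have e2 : MeasureTheory.convolution (fun x ↦ u x) (fun a ↦ fderiv ℝ ψ a h) L volume y
      = ∫ x, φ (x - y) • realPairing h (g x) := by
    rw [← neg_eq_iff_eq_neg.2 (hug.integral_fderiv hφ' (hasCompactSupport_comp_sub hs y) h),
      convolution_def, ← integral_neg]
    refine integral_congr_ae (Filter.Eventually.of_forall fun x ↦ ?_)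
    have h1 : fderiv ℝ (fun x ↦ φ (x - y)) x = fderiv ℝ φ (x - y) := fderiv_comp_sub y
    have h2 : fderiv ℝ ψ (y - x) = - fderiv ℝ φ (x - y) := by
      have : x - y = -(y - x) := by abel
      rw [this, hψ]
      have h3 := (((hφ.differentiable (by simp)) (-(y - x))).hasFDerivAt.comp (y - x)
        (hasFDerivAt_id (y - x)).neg).fderiv
      refine h3.trans ?_
      ext z
      simp
    simp [hL, h1, h2]
  rw [e2]
  refine (norm_integral_smul_le hφ' (hasCompactSupport_comp_sub hs y) h g).trans ?_
  rw [norm_testL2_comp_sub hφ hs y hφ']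
  exact le_of_eq (by ring)

theorem coeFn_translate (h : EuclideanSpace ℝ (Fin d)) (u : L2 d) :
    (DomAddAct.mk h +ᵥ u : L2 d) =ᵐ[volume] fun x ↦ u (h + x) :=
  DomAddAct.vadd_Lp_ae_eq (DomAddAct.mk h) u

theorem inner_testL2_translate {φ : EuclideanSpace ℝ (Fin d) → ℝ} (hφ : ContDiff ℝ ∞ φ)
    (hs : HasCompactSupport φ) (h : EuclideanSpace ℝ (Fin d)) (u : L2 d) :
    inner ℂ (testL2 hφ hs) (DomAddAct.mk h +ᵥ u : L2 d) = ∫ x, φ (x - h) • u x := by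
  rw [inner_testL2, ← integral_add_left_eq_self (fun x ↦ φ (x - h) • u x) h]
  refine integral_congr_ae ?_
  filter_upwards [coeFn_translate h u] with x hx
  rw [hx, add_sub_cancel_left]

/-- Test functions here are real. Splitting a complex one into real and imaginary parts costs the
factor 2; density then allows pairing v with itself. -/
theorem norm_le_of_forall_inner_testL2_le {v : L2 d} {C : ℝ} (hC : 0 ≤ C)
    (h : ∀ (φ : EuclideanSpace ℝ (Fin d) → ℝ) (hφ : ContDiff ℝ ∞ φ) (hs : HasCompactSupport φ),
      ‖inner ℂ (testL2 hφ hs) v‖ ≤ ‖testL2 hφ hs‖ * C) : ‖v‖ ≤ 2 * C := by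
  have hdense := Lp.dense_hasCompactSupport_contDiff (E := EuclideanSpace ℝ (Fin d)) (F := ℂ)
    (μ := volume) (p := 2) (by norm_num)
  have hclosed : IsClosed {f : L2 d | ‖inner ℂ f v‖ ≤ ‖f‖ * (2 * C)} :=
    isClosed_le (by fun_prop) (by fun_prop)
  have hall : ∀ f : L2 d, ‖inner ℂ f v‖ ≤ ‖f‖ * (2 * C) := fun f ↦ by
    refine hclosed.closure_subset_iff.2 ?_ (hdense f)
    rintro f ⟨F, hfF, hFs, hFc⟩
    have hre : ContDiff ℝ ∞ fun x ↦ (F x).re := Complex.reCLM.contDiff.comp hFc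
    have him : ContDiff ℝ ∞ fun x ↦ (F x).im := Complex.imCLM.contDiff.comp hFc
    have hres : HasCompactSupport fun x ↦ (F x).re := hFs.comp_left Complex.zero_re
    have hims : HasCompactSupport fun x ↦ (F x).im := hFs.comp_left Complex.zero_im
    have e : f = testL2 hre hres + Complex.I • testL2 him hims := by
      refine Lp.ext ?_
      filter_upwards [hfF, coeFn_testL2 hre hres, coeFn_testL2 him hims,
        Lp.coeFn_add (testL2 hre hres) (Complex.I • testL2 him hims),
        Lp.coeFn_smul Complex.I (testL2 him hims)] with x h1 h2 h3 h4 h5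
      rw [h4, Pi.add_apply, h5, Pi.smul_apply, h1, h2, h3, smul_eq_mul, mul_comm,
        Complex.re_add_im]
    have n1 : ‖testL2 hre hres‖ ≤ ‖f‖ := by
      refine Lp.norm_le_norm_of_ae_le ?_
      filter_upwards [hfF, coeFn_testL2 hre hres] with x h1 h2
      rw [h1, h2, Complex.norm_real]
      exact Complex.abs_re_le_norm _
    have n2 : ‖testL2 him hims‖ ≤ ‖f‖ := by
      refine Lp.norm_le_norm_of_ae_le ?_
      filter_upwards [hfF, coeFn_testL2 him hims] with x h1 h2
      rw [h1, h2, Complex.norm_real]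
      exact Complex.abs_im_le_norm _
    have b1 := h _ hre hres
    have b2 := h _ him hims
    change ‖inner ℂ f v‖ ≤ ‖f‖ * (2 * C)
    have : ‖inner ℂ f v‖ ≤ ‖inner ℂ (testL2 hre hres) v‖ + ‖inner ℂ (testL2 him hims) v‖ := by
      conv_lhs => rw [e, inner_add_left, inner_smul_left]
      refine (norm_add_le _ _).trans ?_
      simp
    have m1 := mul_le_mul_of_nonneg_right n1 hC
    have m2 := mul_le_mul_of_nonneg_right n2 hC
    linarith
  by_cases hv : ‖v‖ = 0
  · rw [hv]
    positivity
  have h1 := hall v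
  rw [inner_self_eq_norm_sq_to_K, norm_pow, RCLike.norm_ofReal, abs_norm, sq] at h1
  exact le_of_mul_le_mul_left h1 (lt_of_le_of_ne (norm_nonneg v) (Ne.symm hv))

/-- Translations move functions in `W^{1,2}` by at most a multiple of the norm of the gradient. -/
theorem HasWeakGradient.norm_translate_sub_le {u : L2 d} {g : L2Field d}
    (hug : HasWeakGradient u g) (h : EuclideanSpace ℝ (Fin d)) :
    ‖(DomAddAct.mk h +ᵥ u : L2 d) - u‖ ≤ 2 * (‖g‖ * ‖h‖) := by
  refine norm_le_of_forall_inner_testL2_le (by positivity) fun φ hφ hs ↦ ?_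
  choose D hD hDn using hug.hasFDerivAt_translate hφ hs
  -- The mean value inequality is applied to the pairing as a function of the translation, so u
  -- itself is never approximated by smooth functions.
  have h1 := convex_univ.norm_image_sub_le_of_norm_hasFDerivWithin_le
    (f := fun y ↦ ∫ x, φ (x - y) • u x) (f' := D) (𝕜 := ℝ)
    (fun y _ ↦ (hD y).hasFDerivWithinAt) (fun y _ ↦ hDn y) (Set.mem_univ 0) (Set.mem_univ h)
  rw [inner_sub_right, inner_testL2_translate, inner_testL2]
  simpa [mul_assoc] using h1

end Translation

/-! ### Norm limits of compact operators -/

theorem isClosed_isCompactOperator (E F : Type*) [NormedAddCommGroup E] [NormedSpace ℂ E]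
    [NormedAddCommGroup F] [NormedSpace ℂ F] [CompleteSpace F] :
    IsClosed {T : E →L[ℂ] F | IsCompactOperator T} :=
  isClosed_setOfPred_isCompactOperator

theorem isClosed_isCompactOperator_apply {V E F : Type*} [NormedAddCommGroup V]
    [NormedSpace ℂ V] [NormedAddCommGroup E] [NormedSpace ℂ E] [NormedAddCommGroup F]
    [NormedSpace ℂ F] [CompleteSpace F] (Φ : V →L[ℂ] E →L[ℂ] F) :
    IsClosed {k : V | IsCompactOperator (Φ k)} :=
  (isClosed_isCompactOperator E F).preimage Φ.continuous

theorem isCompactOperator_of_forall_norm_sub_le {E F : Type*} [NormedAddCommGroup E]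
    [NormedSpace ℂ E] [NormedAddCommGroup F] [NormedSpace ℂ F] [CompleteSpace F] (T : E →L[ℂ] F)
    (h : ∀ δ > 0, ∃ K : E →L[ℂ] F, IsCompactOperator K ∧ ∀ w, ‖T w - K w‖ ≤ δ * ‖w‖) :
    IsCompactOperator T := by
  refine (isClosed_isCompactOperator E F).closure_subset_iff.2 subset_rfl
    (Metric.mem_closure_iff.2 fun δ hδ ↦ ?_)
  obtain ⟨K, hK, hTK⟩ := h (δ / 2) (half_pos hδ)
  refine ⟨K, hK, ?_⟩
  rw [dist_eq_norm]
  exact lt_of_le_of_lt (ContinuousLinearMap.opNorm_le_bound _ (half_pos hδ).le hTK)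
    (half_lt_self hδ)

/-! ### Multiplication operators and square integrable kernels -/

section Multiplication

variable {X : Type*} [MeasurableSpace X] {μ : Measure X}
  {E F : Type*} [NormedAddCommGroup E] [NormedSpace ℂ E] [NormedAddCommGroup F] [NormedSpace ℂ F]

/-- Multiplication by a bounded operator-valued function on `L²`. -/
def mulOp {A : X → E →L[ℂ] F} (hA : MemLp A ⊤ μ) : Lp E 2 μ →L[ℂ] Lp F 2 μ :=
  (ContinuousLinearMap.id ℂ (E →L[ℂ] F)).holderL μ ⊤ 2 2 (hA.toLp A)

theorem coeFn_mulOp {A : X → E →L[ℂ] F} (hA : MemLp A ⊤ μ) (f : Lp E 2 μ) :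
    mulOp hA f =ᵐ[μ] fun x ↦ A x (f x) := by
  filter_upwards [(ContinuousLinearMap.id ℂ (E →L[ℂ] F)).coeFn_holder (r := 2) (hA.toLp A) f,
    hA.coeFn_toLp] with x h1 h2
  change ((ContinuousLinearMap.id ℂ (E →L[ℂ] F)).holder 2 (hA.toLp A) f : X → F) x = _
  rw [h1, h2]
  rfl

/-- The operator with kernel `k`, a square integrable function with values in the dual space. -/
def kernelOp : Lp (E →L[ℂ] ℂ) 2 μ →L[ℂ] E →L[ℂ] Lp ℂ 2 μ :=
  (ContinuousLinearMap.compLpL₂ 2 μ (ContinuousLinearMap.apply ℂ ℂ)).flip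

theorem coeFn_kernelOp (k : Lp (E →L[ℂ] ℂ) 2 μ) (u : E) :
    kernelOp k u =ᵐ[μ] fun x ↦ k x u :=
  ContinuousLinearMap.coeFn_compLp (ContinuousLinearMap.apply ℂ ℂ u) k

/-- Operators with square integrable kernels are compact. -/
theorem isCompactOperator_kernelOp (k : Lp (E →L[ℂ] ℂ) 2 μ) : IsCompactOperator (kernelOp k) := by
  -- An indicator kernel gives an operator of rank at most one; sums and limits preserve
  -- compactness.
  refine Lp.induction (by norm_num) (fun k ↦ IsCompactOperator (kernelOp k)) ?_ ?_ ?_ k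
  · intro c s hs hμs
    have e : kernelOp (indicatorConstLp 2 hs hμs.ne c : Lp (E →L[ℂ] ℂ) 2 μ)
        = (ContinuousLinearMap.toSpanSingleton ℂ
            (indicatorConstLp 2 hs hμs.ne (1 : ℂ) : Lp ℂ 2 μ)) ∘L c := by
      ext1 u
      refine Lp.ext ?_
      filter_upwards [coeFn_kernelOp (indicatorConstLp 2 hs hμs.ne c : Lp (E →L[ℂ] ℂ) 2 μ) u,
        indicatorConstLp_coeFn (p := 2) (hs := hs) (hμs := hμs.ne) (c := c),
        indicatorConstLp_coeFn (p := 2) (hs := hs) (hμs := hμs.ne) (c := (1 : ℂ)),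
        Lp.coeFn_smul (c u) (indicatorConstLp 2 hs hμs.ne (1 : ℂ) : Lp ℂ 2 μ)] with x h1 h2 h3 h4
      rw [h1, h2, ContinuousLinearMap.comp_apply, ContinuousLinearMap.toSpanSingleton_apply, h4,
        Pi.smul_apply, h3]
      by_cases hx : x ∈ s <;> simp [hx]
    change IsCompactOperator (kernelOp (indicatorConstLp 2 hs hμs.ne c : Lp (E →L[ℂ] ℂ) 2 μ))
    rw [e]
    exact (isCompactOperator_of_locallyCompactSpace_dom c).clm_comp
      (ContinuousLinearMap.toSpanSingleton ℂ (indicatorConstLp 2 hs hμs.ne (1 : ℂ) : Lp ℂ 2 μ))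
  · intro f g hf hg _ h1 h2
    have e : kernelOp (hf.toLp f + hg.toLp g) = kernelOp (hf.toLp f) + kernelOp (hg.toLp g) := by
      exact map_add kernelOp _ _
    rw [e]
    exact h1.add h2
  · exact isClosed_isCompactOperator_apply (F := Lp ℂ 2 μ) kernelOp

variable [TopologicalSpace X] [BorelSpace X] [SecondCountableTopologyEither X (E →L[ℂ] E)]

theorem memLp_top_smul_id {φ : X → ℝ} (hφ : Continuous φ) (hs : HasCompactSupport φ) :
    MemLp (fun x ↦ (φ x : ℂ) • ContinuousLinearMap.id ℂ E) ⊤ μ := by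
  obtain ⟨C, hC⟩ := hφ.bounded_above_of_compact_support hs
  refine memLp_top_of_bound
    ((Complex.continuous_ofReal.comp hφ).smul continuous_const).aestronglyMeasurable
    (C * ‖ContinuousLinearMap.id ℂ E‖) (Filter.Eventually.of_forall fun x ↦ ?_)
  rw [norm_smul, Complex.norm_real]
  exact mul_le_mul_of_nonneg_right (hC x) (norm_nonneg _)

/-- Multiplication by a continuous real function of compact support on `L²`. -/
def cutoffOp {φ : X → ℝ} (hφ : Continuous φ) (hs : HasCompactSupport φ) :
    Lp E 2 μ →L[ℂ] Lp E 2 μ :=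
  mulOp (memLp_top_smul_id (E := E) (μ := μ) hφ hs)

theorem coeFn_cutoffOp {φ : X → ℝ} (hφ : Continuous φ) (hs : HasCompactSupport φ)
    (f : Lp E 2 μ) : cutoffOp hφ hs f =ᵐ[μ] fun x ↦ (φ x : ℂ) • f x :=
  coeFn_mulOp _ f

end Multiplication

/-! ### Approximation of cutoffs by ball averages -/

section Averages

variable {d : ℕ}

/-- The normalized indicator function of a ball. -/
def ballAverage (d : ℕ) (ε : ℝ) : L2 d :=
  indicatorConstLp 2 (Metric.isOpen_ball (x := (0 : EuclideanSpace ℝ (Fin d))) (ε := ε)).measurableSet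
    measure_ball_lt_top.ne
    (((volume (Metric.ball (0 : EuclideanSpace ℝ (Fin d)) ε)).toReal⁻¹ : ℝ) : ℂ)

/-- Writing the mean over a ball around x as an inner product exhibits it as a bounded functional of
u, which serves as the kernel at x. -/
theorem inner_translate_ballAverage (ε : ℝ) (u : L2 d) (x : EuclideanSpace ℝ (Fin d)) :
    inner ℂ (DomAddAct.mk (-x) +ᵥ ballAverage d ε : L2 d) u
      = ∫ h, u (h + x) ∂(ProbabilityTheory.cond volume (Metric.ball 0 ε)) := by
  rw [L2.inner_def, ← integral_add_right_eq_self _ x, ProbabilityTheory.cond,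
    integral_smul_measure, ← integral_indicator Metric.isOpen_ball.measurableSet, ← integral_smul]
  have h1 := (measurePreserving_add_right volume x).quasiMeasurePreserving.ae
    (coeFn_translate (-x) (ballAverage d ε))
  refine integral_congr_ae ?_
  filter_upwards [h1, indicatorConstLp_coeFn (p := 2) (μ := volume)
    (hs := (Metric.isOpen_ball (x := (0 : EuclideanSpace ℝ (Fin d))) (ε := ε)).measurableSet)
    (hμs := measure_ball_lt_top.ne)
    (c := (((volume (Metric.ball (0 : EuclideanSpace ℝ (Fin d)) ε)).toReal⁻¹ : ℝ) : ℂ))] with h h2 h3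
  have h4 : -x + (h + x) = h := by abel
  rw [h2, h4, ballAverage, h3]
  by_cases hh : h ∈ Metric.ball (0 : EuclideanSpace ℝ (Fin d)) ε
  · simp [hh, mul_comm, ENNReal.toReal_inv]
  · simp [hh]

/-- The kernel of the operator which averages over balls and then cuts off. -/
def averageKernel (d : ℕ) (φ : EuclideanSpace ℝ (Fin d) → ℝ) (ε : ℝ)
    (x : EuclideanSpace ℝ (Fin d)) : L2 d →L[ℂ] ℂ :=
  (φ x : ℂ) • innerSL ℂ (DomAddAct.mk (-x) +ᵥ ballAverage d ε : L2 d)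

/-- Translation acts continuously on L², so the kernel is continuous with compact support. -/
theorem memLp_averageKernel {φ : EuclideanSpace ℝ (Fin d) → ℝ} (hφ : Continuous φ)
    (hs : HasCompactSupport φ) (ε : ℝ) : MemLp (averageKernel d φ ε) 2 volume := by
  have : Fact ((2 : ENNReal) ≠ ⊤) := ⟨by norm_num⟩
  have hc : Continuous fun x : EuclideanSpace ℝ (Fin d) ↦
      (DomAddAct.mk (-x) +ᵥ ballAverage d ε : L2 d) := by
    have : Continuous fun x : EuclideanSpace ℝ (Fin d) ↦ DomAddAct.mk (-x) :=
      DomAddAct.mkHomeomorph.continuous.comp continuous_neg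
    exact this.vadd continuous_const
  refine Continuous.memLp_of_hasCompactSupport
    ((Complex.continuous_ofReal.comp hφ).smul ((innerSL ℂ).continuous.comp hc)) ?_
  exact hs.mono fun x hx ↦ by
    contrapose! hx
    simp only [Function.mem_support, not_not] at hx ⊢
    rw [averageKernel, hx, Complex.ofReal_zero]
    exact zero_smul ℂ (innerSL ℂ (DomAddAct.mk (-x) +ᵥ ballAverage d ε : L2 d))

theorem enorm_integral_sq_le {Ω : Type*} [MeasurableSpace Ω] (P : Measure Ω)
    [IsProbabilityMeasure P] {f : Ω → ℂ} (hf : AEStronglyMeasurable f P) :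
    ‖∫ t, f t ∂P‖ₑ ^ 2 ≤ ∫⁻ t, ‖f t‖ₑ ^ 2 ∂P := by
  have h1 : ‖∫ t, f t ∂P‖ₑ ≤ eLpNorm f 2 P := by
    refine (enorm_integral_le_lintegral_enorm f).trans ?_
    rw [← eLpNorm_one_eq_lintegral_enorm]
    exact eLpNorm_le_eLpNorm_of_exponent_le (by norm_num) hf
  calc ‖∫ t, f t ∂P‖ₑ ^ 2 ≤ eLpNorm f 2 P ^ 2 := by gcongr
    _ = _ := by
      rw [eLpNorm_eq_lintegral_rpow_enorm_toReal (by norm_num) (by norm_num)]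
      rw [← ENNReal.rpow_natCast, ← ENNReal.rpow_mul]
      simp

theorem enorm_sq_eq_lintegral {E : Type*} [NormedAddCommGroup E] {X : Type*} [MeasurableSpace X]
    {μ : Measure X} (f : Lp E 2 μ) : ‖f‖ₑ ^ 2 = ∫⁻ x, ‖f x‖ₑ ^ 2 ∂μ := by
  rw [Lp.enorm_def, eLpNorm_eq_lintegral_rpow_enorm_toReal (by norm_num) (by norm_num),
    ← ENNReal.rpow_natCast, ← ENNReal.rpow_mul]
  simp

/-- On `W^{1,2}`, a cutoff is approximated by operators with square integrable kernels. -/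
theorem HasWeakGradient.norm_cutoffOp_sub_le {u : L2 d} {g : L2Field d}
    (hug : HasWeakGradient u g) {φ : EuclideanSpace ℝ (Fin d) → ℝ} (hφ : Continuous φ)
    (hs : HasCompactSupport φ) {C : ℝ} (hC : ∀ x, ‖φ x‖ ≤ C) {ε : ℝ} (hε : 0 < ε) :
    ‖cutoffOp hφ hs u - kernelOp ((memLp_averageKernel hφ hs ε).toLp _) u‖
      ≤ C * (2 * (‖g‖ * ε)) := by
  have hC0 : 0 ≤ C := (norm_nonneg _).trans (hC 0)
  set B := Metric.ball (0 : EuclideanSpace ℝ (Fin d)) ε with hB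
  set P := ProbabilityTheory.cond volume B with hP
  have hBpos : volume B ≠ 0 := (Metric.measure_ball_pos volume 0 hε).ne'
  have hPprob : IsProbabilityMeasure P :=
    ProbabilityTheory.cond_isProbabilityMeasure_of_finite hBpos measure_ball_lt_top.ne
  have hBfin : IsFiniteMeasure (volume.restrict B) := ⟨by simpa using measure_ball_lt_top⟩
  have hum := (Lp.stronglyMeasurable u).measurable
  have hint : ∀ x, Integrable (fun h ↦ u (h + x)) P := fun x ↦ by
    have h1 : MemLp (fun h ↦ u (h + x)) 2 volume :=
      (Lp.memLp u).comp_measurePreserving (measurePreserving_add_right volume x)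
    have h2 : Integrable (fun h ↦ u (h + x)) (volume.restrict B) :=
      (h1.restrict B).integrable (by norm_num)
    exact h2.smul_measure (ENNReal.inv_ne_top.2 hBpos)
  -- The error at x is φ(x) times the mean of u(x) - u(h + x) over the ball; Jensen's inequality
  -- bounds its square.
  have hpt : ∀ᵐ x, ‖(cutoffOp hφ hs u - kernelOp ((memLp_averageKernel hφ hs ε).toLp _) u : L2 d) x‖ₑ ^ 2
      ≤ ENNReal.ofReal C ^ 2 * ∫⁻ h, ‖u (h + x) - u x‖ₑ ^ 2 ∂P := by
    filter_upwards [Lp.coeFn_sub (cutoffOp hφ hs u)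
        (kernelOp ((memLp_averageKernel hφ hs ε).toLp _) u), coeFn_cutoffOp hφ hs u,
      coeFn_kernelOp ((memLp_averageKernel hφ hs ε).toLp _) u,
      (memLp_averageKernel hφ hs ε).coeFn_toLp] with x h1 h2 h3 h4
    have h5 : cutoffOp hφ hs u x - kernelOp ((memLp_averageKernel hφ hs ε).toLp _) u x
        = -((φ x : ℂ) * ∫ h, (u (h + x) - u x) ∂P) := by
      have h6 : averageKernel d φ ε x u = (φ x : ℂ) * ∫ h, u (h + x) ∂P := by
        rw [hP, hB, ← inner_translate_ballAverage]
        rfl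
      rw [h2, h3, h4, h6, integral_sub (hint x) (integrable_const _), integral_const]
      simp
      ring
    rw [h1, Pi.sub_apply, h5, enorm_neg, enorm_mul, mul_pow]
    have h7 : ‖(φ x : ℂ)‖ₑ ≤ ENNReal.ofReal C := by
      rw [← ofReal_norm, Complex.norm_real]
      exact ENNReal.ofReal_le_ofReal (hC x)
    gcongr
    exact enorm_integral_sq_le P ((hint x).sub (integrable_const _)).aestronglyMeasurable
  have hin : ∀ h ∈ B, ∫⁻ x, ‖u (h + x) - u x‖ₑ ^ 2 ≤ ENNReal.ofReal (2 * (‖g‖ * ε)) ^ 2 := by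
    intro h hh
    have h1 : ∫⁻ x, ‖u (h + x) - u x‖ₑ ^ 2
        = ‖(DomAddAct.mk h +ᵥ u : L2 d) - u‖ₑ ^ 2 := by
      rw [enorm_sq_eq_lintegral]
      refine lintegral_congr_ae ?_
      filter_upwards [Lp.coeFn_sub (DomAddAct.mk h +ᵥ u : L2 d) u, coeFn_translate h u]
        with x h2 h3
      rw [h2, Pi.sub_apply, h3]
    rw [h1]
    gcongr
    rw [← ofReal_norm]
    refine ENNReal.ofReal_le_ofReal ((hug.norm_translate_sub_le h).trans ?_)
    have : ‖h‖ ≤ ε := by simpa [hB] using (mem_ball_zero_iff.1 hh).le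
    gcongr
  have hmeas : Measurable (Function.uncurry fun x h : EuclideanSpace ℝ (Fin d) ↦
      ‖u (h + x) - u x‖ₑ ^ 2) := by
    have h1 : Measurable fun p : EuclideanSpace ℝ (Fin d) × EuclideanSpace ℝ (Fin d) ↦
        u (p.2 + p.1) := hum.comp (measurable_snd.add measurable_fst)
    have h2 : Measurable fun p : EuclideanSpace ℝ (Fin d) × EuclideanSpace ℝ (Fin d) ↦
        u p.1 := hum.comp measurable_fst
    exact (h1.sub h2).enorm.pow_const 2
  have hsq : ‖cutoffOp hφ hs u - kernelOp ((memLp_averageKernel hφ hs ε).toLp _) u‖ₑ ^ 2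
      ≤ (ENNReal.ofReal C * ENNReal.ofReal (2 * (‖g‖ * ε))) ^ 2 := by
    rw [enorm_sq_eq_lintegral, mul_pow]
    refine (lintegral_mono_ae hpt).trans ?_
    -- By Tonelli, integrating in x first produces squared norms of translation differences, bounded
    -- uniformly for h in the ball by `hin`.
    rw [lintegral_const_mul' _ _ (by finiteness), lintegral_lintegral_swap hmeas.aemeasurable]
    gcongr
    have h1 : ∀ᵐ h ∂P, ∫⁻ x, ‖u (h + x) - u x‖ₑ ^ 2 ≤ ENNReal.ofReal (2 * (‖g‖ * ε)) ^ 2 := by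
      filter_upwards [ProbabilityTheory.ae_cond_mem Metric.isOpen_ball.measurableSet] with h hh
      exact hin h hh
    refine (lintegral_mono_ae h1).trans ?_
    simp
  have h1 : ‖cutoffOp hφ hs u - kernelOp ((memLp_averageKernel hφ hs ε).toLp _) u‖ₑ
      ≤ ENNReal.ofReal C * ENNReal.ofReal (2 * (‖g‖ * ε)) :=
    (ENNReal.pow_le_pow_left_iff (by norm_num)).1 hsq
  rw [← ENNReal.ofReal_mul hC0, ← ofReal_norm] at h1
  exact (ENNReal.ofReal_le_ofReal_iff (by positivity)).1 h1

end Averages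

/-! ### The Hilbert space W^{1,2} and Rellich's theorem -/

section FormDomain

variable {d : ℕ}

/-- The `i`-th component of a field. -/
def coordOp (i : Fin d) : L2Field d →L[ℂ] L2 d :=
  (EuclideanSpace.proj i : EuclideanSpace ℂ (Fin d) →L[ℂ] ℂ).compLpL 2 volume

theorem coeFn_coordOp (i : Fin d) (g : L2Field d) :
    coordOp i g =ᵐ[volume] fun x ↦ g x i :=
  (EuclideanSpace.proj i : EuclideanSpace ℂ (Fin d) →L[ℂ] ℂ).coeFn_compLpL g

/-- The field whose only nonzero component is the `i`-th one. -/
def embedOp (i : Fin d) : L2 d →L[ℂ] L2Field d :=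
  (ContinuousLinearMap.toSpanSingleton ℂ
    (EuclideanSpace.single i 1 : EuclideanSpace ℂ (Fin d))).compLpL 2 volume

theorem coordOp_embedOp (i j : Fin d) (f : L2 d) :
    coordOp j (embedOp i f) = if j = i then f else 0 := by
  have h0 := Lp.coeFn_zero ℂ 2 (volume : Measure (EuclideanSpace ℝ (Fin d)))
  refine Lp.ext ?_
  filter_upwards [coeFn_coordOp j (embedOp i f), (ContinuousLinearMap.toSpanSingleton ℂ
    (EuclideanSpace.single i 1 : EuclideanSpace ℂ (Fin d))).coeFn_compLpL (p := 2) f, h0]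
    with x h1 h2 h3
  rw [h1, embedOp, h2]
  by_cases h : j = i
  · simp [h]
  · rw [if_neg h, h3]
    simp [h]

/-- The space `W^{1,2}(ℝ^d)` with its Hilbert space structure, as the graph of the gradient. -/
def gradSpace (d : ℕ) : Submodule ℂ (WithLp 2 (L2 d × L2Field d)) :=
  (weakGradientGraph d).comap (WithLp.linearEquiv 2 ℂ (L2 d × L2Field d)).toLinearMap

/-- Expresses the weak gradient through equations between continuous functionals of (u, g), so that
its graph is closed. -/
theorem hasWeakGradient_iff_inner (u : L2 d) (g : L2Field d) :
    HasWeakGradient u g ↔ ∀ (φ : EuclideanSpace ℝ (Fin d) → ℝ) (hφ : ContDiff ℝ ∞ φ)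
      (hs : HasCompactSupport φ) (i : Fin d) (hφ' : ContDiff ℝ ∞ (partialDeriv i φ)),
      inner ℂ (testL2 hφ' (hasCompactSupport_partialDeriv hs i)) u
        = - inner ℂ (testL2 hφ hs) (coordOp i g) := by
  have e : ∀ (φ : EuclideanSpace ℝ (Fin d) → ℝ) (i : Fin d),
      ∫ x, φ x • coordOp i g x = ∫ x, φ x • g x i := fun φ i ↦ by
    refine integral_congr_ae ?_
    filter_upwards [coeFn_coordOp i g] with x hx
    rw [hx]
  simp only [inner_testL2, e]
  refine ⟨fun h φ hφ hs i _ ↦ h φ hφ hs i, fun h φ hφ hs i ↦ h φ hφ hs i ?_⟩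
  exact (hφ.fderiv_right (m := ∞) (by simp)).clm_apply contDiff_const

theorem isClosed_gradSpace : IsClosed (gradSpace d : Set (WithLp 2 (L2 d × L2Field d))) := by
  have : (gradSpace d : Set (WithLp 2 (L2 d × L2Field d))) = {p | HasWeakGradient p.fst p.snd} := rfl
  rw [this]
  simp only [hasWeakGradient_iff_inner]
  have c1 : Continuous fun p : WithLp 2 (L2 d × L2Field d) ↦ p.fst :=
    (WithLp.fstL 2 ℂ (L2 d) (L2Field d)).continuous
  have c2 : Continuous fun p : WithLp 2 (L2 d × L2Field d) ↦ p.snd :=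
    (WithLp.sndL 2 ℂ (L2 d) (L2Field d)).continuous
  simp only [Set.ofPred_forall]
  refine isClosed_iInter fun φ ↦ isClosed_iInter fun hφ ↦ isClosed_iInter fun hs ↦
    isClosed_iInter fun i ↦ isClosed_iInter fun hφ' ↦ isClosed_eq ?_ ?_
  · exact continuous_const.inner c1
  · exact (continuous_const.inner ((coordOp i).continuous.comp c2)).neg

instance : CompleteSpace (gradSpace d) := isClosed_gradSpace.completeSpace_coe

/-- The embedding of `W^{1,2}` into `L²`. -/
def inclOp (d : ℕ) : gradSpace d →L[ℂ] L2 d :=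
  WithLp.fstL 2 ℂ (L2 d) (L2Field d) ∘L (gradSpace d).subtypeL

/-- The gradient on `W^{1,2}`. -/
def gradOp (d : ℕ) : gradSpace d →L[ℂ] L2Field d :=
  WithLp.sndL 2 ℂ (L2 d) (L2Field d) ∘L (gradSpace d).subtypeL

theorem hasWeakGradient_gradOp (w : gradSpace d) : HasWeakGradient (inclOp d w) (gradOp d w) :=
  w.2

theorem norm_sq_gradSpace (w : gradSpace d) :
    ‖w‖ ^ 2 = ‖inclOp d w‖ ^ 2 + ‖gradOp d w‖ ^ 2 :=
  WithLp.prod_norm_sq_eq_of_L2 (w : WithLp 2 (L2 d × L2Field d))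

theorem exists_gradSpace {u : L2 d} {g : L2Field d} (hug : HasWeakGradient u g) :
    ∃ w : gradSpace d, inclOp d w = u ∧ gradOp d w = g :=
  ⟨⟨WithLp.toLp 2 (u, g), hug⟩, rfl, rfl⟩

/-- The Rellich theorem: cutoffs are compact from `W^{1,2}` to `L²`. -/
theorem isCompactOperator_cutoffOp_inclOp {φ : EuclideanSpace ℝ (Fin d) → ℝ} (hφ : Continuous φ)
    (hs : HasCompactSupport φ) :
    IsCompactOperator (cutoffOp (E := ℂ) (μ := volume) hφ hs ∘L inclOp d) := by
  obtain ⟨C, hC⟩ := hφ.bounded_above_of_compact_support hs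
  have hC0 : 0 ≤ C := (norm_nonneg _).trans (hC 0)
  refine isCompactOperator_of_forall_norm_sub_le _ fun δ hδ ↦ ?_
  -- The averaging error is at most C · 2ε ‖w‖; `C + 1` replaces `C` to avoid dividing by zero.
  set ε := δ / ((C + 1) * 2) with hε
  have hεpos : 0 < ε := by positivity
  have hK : IsCompactOperator
      (kernelOp ((memLp_averageKernel hφ hs ε).toLp _) ∘L inclOp d) :=
    (isCompactOperator_kernelOp ((memLp_averageKernel hφ hs ε).toLp _)).comp_clm (inclOp d)
  refine ⟨_, hK, fun w ↦ ?_⟩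
  have h1 := (hasWeakGradient_gradOp w).norm_cutoffOp_sub_le hφ hs hC hεpos
  refine h1.trans ?_
  have h2 : ‖gradOp d w‖ ≤ ‖w‖ := by
    refine le_of_sq_le_sq ?_ (norm_nonneg w)
    rw [norm_sq_gradSpace w]
    nlinarith [sq_nonneg ‖inclOp d w‖]
  have h3 : (C + 1) * (2 * ε) = δ := by
    rw [hε]
    field_simp
  rw [← h3]
  nlinarith [mul_le_mul_of_nonneg_right h2 hεpos.le, mul_nonneg (norm_nonneg w) hεpos.le,
    mul_nonneg (norm_nonneg (gradOp d w)) hεpos.le]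

end FormDomain

/-! ### Cutoffs acting on W^{1,2} -/

section Cutoff

variable {d : ℕ} {η : EuclideanSpace ℝ (Fin d) → ℝ}

/-- Multiplication by the gradient of a test function. -/
def mulGrad (hη : ContDiff ℝ ∞ η) (hs : HasCompactSupport η) : L2 d →L[ℂ] L2Field d :=
  ∑ i, embedOp i ∘L cutoffOp (E := ℂ) (μ := volume) (continuous_partialDeriv hη i)
    (hasCompactSupport_partialDeriv hs i)

theorem coordOp_mulGrad (hη : ContDiff ℝ ∞ η) (hs : HasCompactSupport η) (j : Fin d) (f : L2 d) :
    coordOp j (mulGrad hη hs f) = cutoffOp (E := ℂ) (μ := volume) (continuous_partialDeriv hη j)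
      (hasCompactSupport_partialDeriv hs j) f := by
  rw [mulGrad, sum_apply, map_sum]
  simp only [ContinuousLinearMap.comp_apply, coordOp_embedOp]
  simp

/-- The product rule for a cutoff. -/
theorem HasWeakGradient.cutoff {u : L2 d} {g : L2Field d} (hug : HasWeakGradient u g)
    (hη : ContDiff ℝ ∞ η) (hs : HasCompactSupport η) :
    HasWeakGradient (cutoffOp (E := ℂ) (μ := volume) hη.continuous hs u)
      (cutoffOp (E := EuclideanSpace ℂ (Fin d)) (μ := volume) hη.continuous hs g
        + mulGrad hη hs u) := by
  intro ψ hψ hψs i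
  have mη : MemLp η 2 := memLp_testFunction hη.continuous hs
  have hc : ContDiff ℝ ∞ fun x ↦ ψ x * η x := hψ.mul hη
  have hcs : HasCompactSupport fun x ↦ ψ x * η x := hψs.mul_right
  have hpd : ∀ x, partialDeriv i (fun x ↦ ψ x * η x) x
      = ψ x * partialDeriv i η x + partialDeriv i ψ x * η x := fun x ↦ by
    rw [partialDeriv, fderiv_fun_mul (hψ.differentiable (by simp) x)
      (hη.differentiable (by simp) x)]
    simp [partialDeriv, mul_comm]
  -- The weak gradient of u is tested with ψ η, and the product rule for this smooth function is
  -- rearranged.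
  have h1 := hug _ hc hcs i
  have i1 : Integrable fun x ↦ (ψ x * partialDeriv i η x) • u x :=
    integrable_smul (memLp_testFunction (hψ.continuous.mul (continuous_partialDeriv hη i))
      hψs.mul_right) (Lp.memLp u)
  have i2 : Integrable fun x ↦ (partialDeriv i ψ x * η x) • u x :=
    integrable_smul (memLp_testFunction ((continuous_partialDeriv hψ i).mul hη.continuous)
      (hasCompactSupport_partialDeriv hψs i).mul_right) (Lp.memLp u)
  have i3 : Integrable fun x ↦ (ψ x * η x) • g x i :=
    integrable_smul (memLp_testFunction (hψ.continuous.mul hη.continuous)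
      hψs.mul_right) (memLp_coord g i)
  simp only [hpd, add_smul] at h1
  rw [integral_add i1 i2] at h1
  have e1 : ∫ x, partialDeriv i ψ x • cutoffOp (E := ℂ) (μ := volume) hη.continuous hs u x
      = ∫ x, (partialDeriv i ψ x * η x) • u x := by
    refine integral_congr_ae ?_
    filter_upwards [coeFn_cutoffOp hη.continuous hs u] with x hx
    rw [hx]
    simp [mul_assoc]
  have e2 : ∫ x, ψ x • (cutoffOp (E := EuclideanSpace ℂ (Fin d)) (μ := volume) hη.continuous hs g
        + mulGrad hη hs u : L2Field d) x i
      = ∫ x, ((ψ x * η x) • g x i + (ψ x * partialDeriv i η x) • u x) := by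
    refine integral_congr_ae ?_
    have h2 := coeFn_coordOp i (mulGrad hη hs u)
    rw [coordOp_mulGrad] at h2
    filter_upwards [h2, coeFn_cutoffOp hη.continuous hs g,
      coeFn_cutoffOp (E := ℂ) (continuous_partialDeriv hη i)
        (hasCompactSupport_partialDeriv hs i) u,
      Lp.coeFn_add (cutoffOp (E := EuclideanSpace ℂ (Fin d)) (μ := volume) hη.continuous hs g)
        (mulGrad hη hs u)] with x h2 h3 h4 h5
    rw [h5, Pi.add_apply, PiLp.add_apply, ← h2, h4, h3]
    simp only [PiLp.smul_apply, smul_eq_mul, Complex.real_smul, Complex.ofReal_mul]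
    ring
  rw [e1, e2, integral_add i3 i1]
  linear_combination h1

/-- Multiplication by a test function on `W^{1,2}`. -/
def cutoffGrad (hη : ContDiff ℝ ∞ η) (hs : HasCompactSupport η) :
    gradSpace d →L[ℂ] gradSpace d :=
  ((WithLp.prodContinuousLinearEquiv 2 ℂ (L2 d) (L2Field d)).symm.toContinuousLinearMap ∘L
    (cutoffOp (E := ℂ) (μ := volume) hη.continuous hs ∘L inclOp d).prod
      (cutoffOp (E := EuclideanSpace ℂ (Fin d)) (μ := volume) hη.continuous hs ∘L gradOp d
        + mulGrad hη hs ∘L inclOp d)).codRestrict (gradSpace d)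
    fun w ↦ (hasWeakGradient_gradOp w).cutoff hη hs

/-- Each ∂ᵢη is again continuous with compact support, so Rellich's theorem applies to every
component. -/
theorem isCompactOperator_mulGrad_inclOp (hη : ContDiff ℝ ∞ η) (hs : HasCompactSupport η) :
    IsCompactOperator (mulGrad hη hs ∘L inclOp d) := by
  have e : mulGrad hη hs ∘L inclOp d = ∑ i, embedOp i ∘L
      (cutoffOp (E := ℂ) (μ := volume) (continuous_partialDeriv hη i)
        (hasCompactSupport_partialDeriv hs i) ∘L inclOp d) := by
    ext1 w
    simp [mulGrad]
  rw [e]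
  have : ∀ i ∈ Finset.univ, embedOp i ∘L
      (cutoffOp (E := ℂ) (μ := volume) (continuous_partialDeriv hη i)
        (hasCompactSupport_partialDeriv hs i) ∘L inclOp d)
      ∈ compactOperator (RingHom.id ℂ) (gradSpace d) (L2Field d) := fun i _ ↦
    (isCompactOperator_cutoffOp_inclOp _ _).clm_comp (embedOp i)
  exact Submodule.sum_mem _ this

theorem isSelfAdjoint_cutoffOp {E : Type*} [NormedAddCommGroup E] [InnerProductSpace ℂ E]
    [CompleteSpace E] {φ : EuclideanSpace ℝ (Fin d) → ℝ} (hφ : Continuous φ)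
    (hs : HasCompactSupport φ) : IsSelfAdjoint (cutoffOp (E := E) (μ := volume) hφ hs) := by
  rw [ContinuousLinearMap.isSelfAdjoint_iff_isSymmetric]
  intro f g
  change inner ℂ (cutoffOp hφ hs f) g = inner ℂ f (cutoffOp hφ hs g)
  rw [L2.inner_def, L2.inner_def]
  refine integral_congr_ae ?_
  filter_upwards [coeFn_cutoffOp hφ hs f, coeFn_cutoffOp hφ hs g] with x h1 h2
  rw [h1, h2, inner_smul_left, inner_smul_right, Complex.conj_ofReal]

end Cutoff

/-! ### The coefficients as an operator on fields -/

section Coefficients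

variable {d : ℕ} {ν : ℝ} {a : EuclideanSpace ℝ (Fin d) → Matrix (Fin d) (Fin d) ℝ}

/-- The action of a real matrix on complex vectors. -/
def matrixAct (m : Matrix (Fin d) (Fin d) ℝ) :
    EuclideanSpace ℂ (Fin d) →L[ℂ] EuclideanSpace ℂ (Fin d) :=
  ∑ i, ∑ j, (m i j : ℂ) • (ContinuousLinearMap.toSpanSingleton ℂ
    (EuclideanSpace.single i 1 : EuclideanSpace ℂ (Fin d))) ∘L EuclideanSpace.proj j

theorem matrixAct_apply (m : Matrix (Fin d) (Fin d) ℝ) (z : EuclideanSpace ℂ (Fin d)) (i : Fin d) :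
    matrixAct m z i = ∑ j, (m i j : ℂ) * z j := by
  simp [matrixAct, Finset.sum_apply, Pi.single_apply, Finset.sum_ite_eq]

theorem inner_matrixAct (m : Matrix (Fin d) (Fin d) ℝ) (z w : EuclideanSpace ℂ (Fin d)) :
    inner ℂ w (matrixAct m z) = ∑ i, (∑ j, (m i j : ℂ) * z j) * conj (w i) := by
  simp [PiLp.inner_apply, matrixAct_apply]

theorem inner_matrixAct_left {m : Matrix (Fin d) (Fin d) ℝ} (hm : m.IsSymm)
    (z w : EuclideanSpace ℂ (Fin d)) :
    inner ℂ (matrixAct m z) w = inner ℂ z (matrixAct m w) := by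
  rw [← inner_conj_symm, inner_matrixAct, inner_matrixAct]
  simp only [map_sum, map_mul, Finset.sum_mul, Complex.conj_conj, Complex.conj_ofReal]
  rw [Finset.sum_comm]
  refine Finset.sum_congr rfl fun i _ ↦ Finset.sum_congr rfl fun j _ ↦ ?_
  rw [hm.apply]
  ring

/-- Carries ellipticity, assumed for real vectors, over to complex ones. -/
theorem re_inner_matrixAct (m : Matrix (Fin d) (Fin d) ℝ) (z : EuclideanSpace ℂ (Fin d)) :
    (inner ℂ z (matrixAct m z)).re = (m *ᵥ fun i ↦ (z i).re) ⬝ᵥ (fun i ↦ (z i).re)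
      + (m *ᵥ fun i ↦ (z i).im) ⬝ᵥ (fun i ↦ (z i).im) := by
  rw [inner_matrixAct, Complex.re_sum]
  simp only [dotProduct, Matrix.mulVec, ← Finset.sum_add_distrib]
  refine Finset.sum_congr rfl fun i _ ↦ ?_
  simp [Complex.mul_re, Complex.re_sum, Complex.im_sum]

theorem re_inner_self_eq (z : EuclideanSpace ℂ (Fin d)) :
    (inner ℂ z z).re = (fun i ↦ (z i).re) ⬝ᵥ (fun i ↦ (z i).re)
      + (fun i ↦ (z i).im) ⬝ᵥ (fun i ↦ (z i).im) := by
  rw [PiLp.inner_apply, Complex.re_sum]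
  simp only [dotProduct, ← Finset.sum_add_distrib]
  refine Finset.sum_congr rfl fun i _ ↦ ?_
  rw [RCLike.inner_apply, Complex.mul_re, Complex.conj_re, Complex.conj_im]
  ring

theorem IsUniformlyElliptic.memLp_matrixAct (ha : IsUniformlyElliptic ν a) :
    MemLp (fun x ↦ matrixAct (a x)) ⊤ volume := by
  refine memLp_top_of_bound (C := ∑ i, ∑ j, ν⁻¹ * ‖(ContinuousLinearMap.toSpanSingleton ℂ
    (EuclideanSpace.single i 1 : EuclideanSpace ℂ (Fin d))) ∘L
    (EuclideanSpace.proj j : EuclideanSpace ℂ (Fin d) →L[ℂ] ℂ)‖) ?_ ?_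
  · refine Finset.aestronglyMeasurable_fun_sum _ fun i _ ↦
      Finset.aestronglyMeasurable_fun_sum _ fun j _ ↦ ?_
    exact (Complex.measurable_ofReal.comp (ha.measurable i j)).aestronglyMeasurable.smul_const _
  · filter_upwards [ha.abs_entry_le] with x hx
    refine norm_sum_le_of_le _ fun i _ ↦ norm_sum_le_of_le _ fun j _ ↦ ?_
    rw [norm_smul, Complex.norm_real]
    exact mul_le_mul_of_nonneg_right (hx i j) (norm_nonneg _)

/-- Multiplication of fields by the coefficients. -/
def IsUniformlyElliptic.coeffOp (ha : IsUniformlyElliptic ν a) : L2Field d →L[ℂ] L2Field d :=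
  mulOp ha.memLp_matrixAct

theorem IsUniformlyElliptic.coeFn_coeffOp (ha : IsUniformlyElliptic ν a) (g : L2Field d) :
    ha.coeffOp g =ᵐ[volume] fun x ↦ matrixAct (a x) (g x) :=
  coeFn_mulOp _ g

theorem IsUniformlyElliptic.inner_coeffOp (ha : IsUniformlyElliptic ν a) (g h : L2Field d) :
    inner ℂ h (ha.coeffOp g) = fieldForm a g h := by
  rw [L2.inner_def, fieldForm]
  refine integral_congr_ae ?_
  filter_upwards [ha.coeFn_coeffOp g] with x hx
  rw [hx, inner_matrixAct]

theorem IsUniformlyElliptic.isSelfAdjoint_coeffOp (ha : IsUniformlyElliptic ν a) :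
    IsSelfAdjoint ha.coeffOp := by
  rw [ContinuousLinearMap.isSelfAdjoint_iff_isSymmetric]
  intro g h
  change inner ℂ (ha.coeffOp g) h = inner ℂ g (ha.coeffOp h)
  rw [L2.inner_def, L2.inner_def]
  refine integral_congr_ae ?_
  filter_upwards [ha.coeFn_coeffOp g, ha.coeFn_coeffOp h, ha.symm] with x h1 h2 h3
  rw [h1, h2, inner_matrixAct_left h3]

theorem IsUniformlyElliptic.le_re_inner_coeffOp (ha : IsUniformlyElliptic ν a) (g : L2Field d) :
    ν * ‖g‖ ^ 2 ≤ (inner ℂ g (ha.coeffOp g)).re := by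
  have h1 : ‖g‖ ^ 2 = (inner ℂ g g).re := (inner_self_eq_norm_sq (𝕜 := ℂ) g).symm
  have r : ∀ f : L2Field d, (inner ℂ g f).re = ∫ x, (inner ℂ (g x) (f x)).re := fun f ↦ by
    rw [L2.inner_def]
    exact (integral_re (L2.integrable_inner (𝕜 := ℂ) g f)).symm
  rw [h1, r, r, ← integral_const_mul]
  refine integral_mono_ae ((L2.integrable_inner (𝕜 := ℂ) g g).re.const_mul ν)
    (L2.integrable_inner (𝕜 := ℂ) g (ha.coeffOp g)).re ?_
  filter_upwards [ha.coeFn_coeffOp g, ha.lower] with x h2 h3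
  rw [h2, re_inner_matrixAct, re_inner_self_eq, mul_add]
  exact add_le_add (h3 _) (h3 _)

end Coefficients

/-! ### The elliptic operator and its resolvent -/

section Operator

variable {d : ℕ} {ν : ℝ} {a : EuclideanSpace ℝ (Fin d) → Matrix (Fin d) (Fin d) ℝ}

theorem IsUniformlyElliptic.isUnit_formOp (ha : IsUniformlyElliptic ν a) :
    IsUnit (formOp (inclOp d) (gradOp d) ha.coeffOp) :=
  DivForm.isUnit_formOp ha.pos norm_sq_gradSpace ha.le_re_inner_coeffOp

theorem exists_W12_of_gradSpace (w : gradSpace d) :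
    ∃ v : W12 d, (v : L2 d) = inclOp d w ∧ weakGradient d v = gradOp d w :=
  LinearPMap.mem_graph_iff _ |>.1
    ((mem_graph_weakGradient _ _).2 (hasWeakGradient_gradOp w))

theorem exists_gradSpace_of_W12 (v : W12 d) :
    ∃ w : gradSpace d, inclOp d w = v ∧ gradOp d w = weakGradient d v :=
  exists_gradSpace ((mem_graph_weakGradient _ _).1 ((weakGradient d).mem_graph v))

/-- Adding ⟨v, u⟩ to both sides of the weak equation for T u = f turns it into the equation that
characterizes `solOp` at f + u. The proof matches the two models of W^{1,2}. -/
theorem isShiftedInverse_operator (ha : IsUniformlyElliptic ν a) :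
    IsShiftedInverse (operator ha) (resolventOp (inclOp d) (gradOp d) ha.coeffOp) := by
  intro u f
  rw [mem_graph_operator]
  constructor
  · rintro ⟨w, rfl, hw⟩
    obtain ⟨w', hw', hgw'⟩ := exists_gradSpace_of_W12 w
    have h1 : w' = solOp (inclOp d) (gradOp d) ha.coeffOp (f + w) := by
      rw [eq_solOp_iff ha.isUnit_formOp]
      intro v
      obtain ⟨v', hv', hgv'⟩ := exists_W12_of_gradSpace v
      have h2 := hw v'
      rw [form, hgv', hv', ← hgw'] at h2
      rw [ha.inner_coeffOp, h2, hw', inner_add_right, add_comm]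
    rw [resolventOp, ContinuousLinearMap.comp_apply, ← h1, hw']
  · intro hu
    set w' := solOp (inclOp d) (gradOp d) ha.coeffOp (f + u) with hw'
    have huw : inclOp d w' = u := hu.symm
    obtain ⟨w, hw, hgw⟩ := exists_W12_of_gradSpace w'
    refine ⟨w, hw.trans huw, fun v ↦ ?_⟩
    obtain ⟨v', hv', hgv'⟩ := exists_gradSpace_of_W12 v
    have h1 := (eq_solOp_iff ha.isUnit_formOp w' (f + u)).1 hw' v'
    rw [ha.inner_coeffOp, hv', hgv', huw, inner_add_right] at h1
    rw [form, hgw]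
    linear_combination h1

theorem re_inner_operator_nonneg (ha : IsUniformlyElliptic ν a) (u : (operator ha).domain) :
    0 ≤ (inner ℂ (operator ha u) (u : L2 d)).re := by
  obtain ⟨w, hw, hform⟩ := (mem_graph_operator ha _ _).1 ((operator ha).mem_graph u)
  have h1 := hform w
  rw [form, ← ha.inner_coeffOp, hw] at h1
  rw [← inner_conj_symm, Complex.conj_re, ← h1]
  exact (mul_nonneg ha.pos.le (sq_nonneg _)).trans (ha.le_re_inner_coeffOp _)

theorem isCompactOperator_resolventOp_sub_of_eq_off_ball
    {a₁ a₂ : EuclideanSpace ℝ (Fin d) → Matrix (Fin d) (Fin d) ℝ}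
    (h₁ : IsUniformlyElliptic ν a₁) (h₂ : IsUniformlyElliptic ν a₂) (R : ℝ)
    (hR : ∀ᵐ x, x ∉ Metric.ball (0 : EuclideanSpace ℝ (Fin d)) R → a₁ x = a₂ x) :
    IsCompactOperator (resolventOp (inclOp d) (gradOp d) h₁.coeffOp
      - resolventOp (inclOp d) (gradOp d) h₂.coeffOp) := by
  -- `max R 1` keeps the inner radius positive even when R is not.
  let b : ContDiffBump (0 : EuclideanSpace ℝ (Fin d)) :=
    ⟨max R 1, max R 1 + 1, by positivity, by linarith⟩
  have hη : ContDiff ℝ ∞ b := b.contDiff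
  have hs : HasCompactSupport b := b.hasCompactSupport
  have hb1 : ∀ x ∈ Metric.ball (0 : EuclideanSpace ℝ (Fin d)) R, b x = 1 := fun x hx ↦
    b.one_of_mem_closedBall
      (Metric.ball_subset_closedBall (Metric.ball_subset_ball (le_max_left R 1) hx))
  refine isCompactOperator_resolventOp_sub (m := cutoffGrad hη hs)
    (θ := cutoffOp (E := ℂ) (μ := volume) hη.continuous hs)
    (Θ := cutoffOp (E := EuclideanSpace ℂ (Fin d)) (μ := volume) hη.continuous hs)
    (R := mulGrad hη hs ∘L inclOp d) h₁.isUnit_formOp h₂.isUnit_formOp rfl rfl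
    (isSelfAdjoint_cutoffOp _ _) (isSelfAdjoint_cutoffOp _ _)
    (isCompactOperator_cutoffOp_inclOp _ _) (isCompactOperator_mulGrad_inclOp hη hs) ?_ ?_
  · ext1 g
    refine Lp.ext ?_
    rw [ContinuousLinearMap.comp_apply, ContinuousLinearMap.comp_apply]
    filter_upwards [h₂.coeFn_coeffOp (cutoffOp hη.continuous hs g), h₂.coeFn_coeffOp g,
      coeFn_cutoffOp hη.continuous hs g,
      coeFn_cutoffOp hη.continuous hs (h₂.coeffOp g)] with x e1 e2 e3 e4
    rw [e1, e4, e2, e3, map_smul]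
  -- On the ball the cutoff equals 1; off the ball the coefficients agree almost everywhere and both
  -- sides vanish.
  · ext1 g
    refine Lp.ext ?_
    rw [ContinuousLinearMap.comp_apply, sub_apply,
      sub_apply]
    filter_upwards [h₁.coeFn_coeffOp (cutoffOp hη.continuous hs g), h₁.coeFn_coeffOp g,
      h₂.coeFn_coeffOp (cutoffOp hη.continuous hs g), h₂.coeFn_coeffOp g,
      coeFn_cutoffOp hη.continuous hs g, hR, Lp.coeFn_sub (h₂.coeffOp g) (h₁.coeffOp g),
      Lp.coeFn_sub (h₂.coeffOp (cutoffOp hη.continuous hs g))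
        (h₁.coeffOp (cutoffOp hη.continuous hs g))] with x e1 e2 e3 e4 e5 e6 e7 e8
    rw [e7, e8, Pi.sub_apply, Pi.sub_apply, e1, e2, e3, e4, e5]
    by_cases hx : x ∈ Metric.ball (0 : EuclideanSpace ℝ (Fin d)) R
    · rw [hb1 x hx, Complex.ofReal_one, one_smul]
    · rw [e6 hx, sub_self, sub_self]

end Operator

end DivForm

end

theorem theoremB1 (d : ℕ) (ν : ℝ)
    (a₁ a₂ : EuclideanSpace ℝ (Fin d) → Matrix (Fin d) (Fin d) ℝ)
    (h₁ : DivForm.IsUniformlyElliptic ν a₁) (h₂ : DivForm.IsUniformlyElliptic ν a₂)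
    (R : ℝ) (hR : ∀ᵐ x, x ∉ Metric.ball (0 : EuclideanSpace ℝ (Fin d)) R → a₁ x = a₂ x) :
    (IsSelfAdjoint (DivForm.operator h₁) ∧ IsSelfAdjoint (DivForm.operator h₂)) ∧
    ((∀ u : (DivForm.operator h₁).domain,
        0 ≤ (inner ℂ (DivForm.operator h₁ u) (u : DivForm.L2 d)).re) ∧
      ∀ u : (DivForm.operator h₂).domain,
        0 ≤ (inner ℂ (DivForm.operator h₂ u) (u : DivForm.L2 d)).re) ∧
    DivForm.essSpec (DivForm.operator h₁) = DivForm.essSpec (DivForm.operator h₂) := by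
  have i₁ := DivForm.isShiftedInverse_operator h₁
  have i₂ := DivForm.isShiftedInverse_operator h₂
  have s₁ := DivForm.isSelfAdjoint_resolventOp (J := DivForm.inclOp d) (G := DivForm.gradOp d)
    h₁.isSelfAdjoint_coeffOp
  have s₂ := DivForm.isSelfAdjoint_resolventOp (J := DivForm.inclOp d) (G := DivForm.gradOp d)
    h₂.isSelfAdjoint_coeffOp
  exact ⟨⟨i₁.isSelfAdjoint s₁, i₂.isSelfAdjoint s₂⟩,
    ⟨DivForm.re_inner_operator_nonneg h₁, DivForm.re_inner_operator_nonneg h₂⟩,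
    DivForm.essSpec_eq_of_isCompactOperator_sub i₁ i₂ s₁ s₂
      (DivForm.isCompactOperator_resolventOp_sub_of_eq_off_ball h₁ h₂ R hR)⟩
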